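/- Let $\rho, J_0, M_0, \Omega > 0$ and $-1<\alpha<1$. Let $J=J^{(\alpha,\Omega)}$ be the Strick–Mainardi creep compliance, $$J(t) = J_0 + \frac{M_0}{\alpha}\left[{}_1F_1(-\alpha,1;-\Omega t) - 1\right]\ (\alpha\neq 0),\qquad J(t) = J_0 + M_0\,\mathrm{Ein}(\Omega t)\ (\alpha = 0),\qquad t \ge 0,$$ where $\mathrm{Ein}(z)=\int_0^z \frac{1-e^{-s}}{s}\,ds$, let $\tilde J$ be its Laplace transform, and let $$\kappa(p) = \rho^{1/2}\,p\,[p\,\tilde J(p)]^{1/2}\quad (p>0),\qquad \frac1{c_0} = \lim_{p\to\infty}\frac{\kappa(p)}{p} .$$ Then $1/c_0 = (\rho J_0)^{1/2}$, and there is exactly one Borel measure $\nu$ on $]0,\infty[$ (the dispersion–attenuation measure) with $\int_{]0,\infty[}\frac{\nu(dr)}{1+r}<\infty$ and $$\kappa(p) = \frac{p}{c_0} + p\int_{]0,\infty[}\frac{\nu(dr)}{p+r}\qquad\text{for all } p>0 .$$ It has the non-negative density $\nu(dr)=h(r)\,dr$ with $$h(r) = \frac{\rho^{1/2}}{\pi}\,\mathrm{Im}\left\{[p\,\tilde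 J(p)]^{1/2}\right\}_{p = r e^{-i\pi}},\qquad r>0,$$ where $p\,\tilde J(p)$ stands for its analytic continuation $J_0+\frac{M_0}{\alpha}\left[(1+\Omega/p)^\alpha-1\right]$ (for $\alpha=0$: $J_0+M_0\ln(1+\Omega/p)$) to $\mathbb{C}\setminus[-\Omega,0]$, with its boundary value from below on the cut, and powers and logarithms are principal. Put $g(t) = \int_{]0,\infty[} e^{-rt}\,\nu(dr)$ for $t>0$. Then: 1. If $0<\alpha<1$, then, with $C = \sqrt{\dfrac{\rho M_0\Omega^\alpha}{\alpha}}\;\dfrac{\sin(\alpha\pi/2)}{\pi}$, $$h(r)\sim C\,r^{-\alpha/2}\ \ (r\to 0+),\qquad g(t)\sim \Gamma(1-\alpha/2)\,C\,t^{\alpha/2-1}\ \ (t\to\infty).$$ 2. If $-1<\alpha<0$, then $\lim_{r\to0+}h(r) = 0$ and $\lim_{t\to\infty} t\,g(t) = 0$. 3. If $\alpha=0$, then, with $C = \tfrac12\sqrt{\rho M_0}$, $$h(r)\sim C\,\ln^{-1/2}\!\left(\frac{\Omega}{r}-1\right)\ \ (r\to0+),\qquad g(t)\sim \frac{C}{t\,\ln^{1/2}(\Omega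 t)}\ \ (t\to\infty).$$ -/

import Mathlib

open Filter Topology MeasureTheory Set Asymptotics

noncomputable section

/-- Kummer's confluent hypergeometric function `₁F₁(a, b; z) = ∑ (a)ₙ / (b)ₙ * zⁿ / n!`
(the series converges for every `z` as soon as `b` is not a nonpositive integer). -/
def kummerF (a b z : ℝ) : ℝ :=
  ∑' n : ℕ, (ascPochhammer ℝ n).eval a / (ascPochhammer ℝ n).eval b * (z ^ n / (n.factorial : ℝ))

/-- The modified exponential integral `Ein z = ∫₀ᶻ (1 - e⁻ˢ) / s ds`. -/
def modExpIntegral (z : ℝ) : ℝ :=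
  ∫ s in (0 : ℝ)..z, (1 - Real.exp (-s)) / s

/-- The Strick-Mainardi creep compliance `J^(α,Ω)(t)`, which for `α = 0` is
Becker's creep compliance. -/
def strickMainardiCreep (J₀ M₀ Ω α t : ℝ) : ℝ :=
  if α = 0 then J₀ + M₀ * modExpIntegral (Ω * t)
  else J₀ + M₀ / α * (kummerF (-α) 1 (-(Ω * t)) - 1)

/-- The Laplace transform of a function on `]0,∞[`, at a real argument. -/
def laplaceTransform (f : ℝ → ℝ) (p : ℝ) : ℝ :=
  ∫ t in Ioi (0 : ℝ), Real.exp (-(p * t)) * f t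

/-- The wavenumber function `κ(p) = ρ^(1/2) p [p J~(p)]^(1/2)`, `p > 0`, of a medium with
density `ρ` and creep compliance `J`. -/
def wavenumber (ρ : ℝ) (J : ℝ → ℝ) (p : ℝ) : ℝ :=
  √ρ * p * √(p * laplaceTransform J p)

/-- `ν` is the dispersion-attenuation measure of the medium with density `ρ` and creep
compliance `J`, and `c₀` is its wavefront speed: `1 / c₀` is the limit of `κ(p) / p` at infinity,
and `ν` is the measure on `]0,∞[` in the integral representation of the complete Bernstein
function `κ`. -/
structure IsAttenuationMeasure (ρ : ℝ) (J : ℝ → ℝ) (c₀ : ℝ) (ν : Measure ℝ) : Prop where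
  speed_pos : 0 < c₀
  tendsto_speed : Tendsto (fun p : ℝ => wavenumber ρ J p / p) atTop (𝓝 (1 / c₀))
  support : ν (Iic 0) = 0
  lintegral_lt_top : ∫⁻ r in Ioi (0 : ℝ), ENNReal.ofReal (1 / (1 + r)) ∂ν < ⊤
  representation : ∀ p : ℝ, 0 < p →
    wavenumber ρ J p = p / c₀ + p * ∫ r in Ioi (0 : ℝ), 1 / (p + r) ∂ν

/-- The function `g(t) = ∫_{]0,∞[} e^(-r t) ν(dr)`. -/
def relaxationG (ν : Measure ℝ) (t : ℝ) : ℝ :=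
  ∫ r in Ioi (0 : ℝ), Real.exp (-(r * t)) ∂ν

/-- The analytic function `p J~(p)` of the Strick-Mainardi creep compliance `J` on the complex
plane cut along `[-Ω, 0]`. On the cut the principal powers and logarithms of Mathlib (argument
`π` on the negative half-axis) give `1 + Ω / p` the argument `π`, so that the value at `-r` is
the boundary value at `p = r e^(-iπ)`, from below the cut. -/
def strickMainardiCarson (J₀ M₀ Ω α : ℝ) (p : ℂ) : ℂ :=
  if α = 0 then J₀ + M₀ * Complex.log (1 + Ω / p)
  else J₀ + M₀ / α * ((1 + Ω / p) ^ (α : ℂ) - 1)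

/-- The attenuation spectral density
`h(r) = (ρ^(1/2) / π) Im {[p J~(p)]^(1/2)}` at `p = r e^(-iπ)`, `r > 0`. -/
def attenuationDensity (ρ J₀ M₀ Ω α r : ℝ) : ℝ :=
  √ρ / Real.pi * (strickMainardiCarson J₀ M₀ Ω α (-(r : ℂ)) ^ (1 / 2 : ℂ)).im

end

/-! In the variable w = 1 + Ω/p, the function p J~(p) is J₀ + (M₀/α)(w^α − 1), or J₀ + M₀ log w when
α = 0. For |α| < 1 it maps the upper half-plane of w into itself, and p in the lower half-plane
gives w in the upper one. So its principal square root F is analytic for Im p < 0. It is real for p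
> 0, equals √J₀ + O(1/p) at infinity, and is bounded on the vertical lines by a locally integrable
function of Re p. Cauchy's theorem in the lower half-plane then recovers F(p) from Im F on the
negative half-axis (`stieltjes_representation`). Multiplied by √ρ p, this is the required
representation with density h, and √(ρJ₀) is the limit of κ(p)/p.

Uniqueness: s = 1/(1 + r) carries ν(dr)/(1 + r) to a finite measure on [0, 1]. The Stieltjes
transform determines its moments, hence its characteristic function
(`eq_of_stieltjes_transform_eq`).

Asymptotics: for 0 < r < Ω the boundary value z of p J~(p) is explicit, and Im √z = √((|z| − Re
z)/2) gives the behaviour of h at 0. It passes to g by the Abelian theorem `tendsto_mul_laplace`: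
substitute s = rt and use dominated convergence. -/

/-! ### Laplace transform of the creep compliance -/

theorem ascPochhammer_eval_neg_div_factorial (a : ℝ) (n : ℕ) :
    (ascPochhammer ℝ n).eval (-a) / (n.factorial : ℝ) = (-1) ^ n * Ring.choose a n := by
  have h := Ring.factorial_nsmul_multichoose_eq_ascPochhammer (-a) n
  have h2 := Ring.choose_neg' (-a) n
  rw [Polynomial.ascPochhammer_smeval_eq_eval, nsmul_eq_mul] at h
  rw [← h, mul_div_cancel_left₀ _ (by positivity)]
  rw [neg_neg] at h2
  rw [h2, Units.smul_def, zsmul_eq_mul, ← mul_assoc]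
  rcases Nat.even_or_odd n with hn | hn
  · simp [hn.neg_one_pow, Int.negOnePow_even n (by exact_mod_cast hn)]
  · simp [hn.neg_one_pow, Int.negOnePow_odd n (by exact_mod_cast hn)]

theorem kummerF_neg_one_eq_tsum (a x : ℝ) :
    kummerF (-a) 1 (-x) = ∑' n : ℕ, Ring.choose a n * (x ^ n / (n.factorial : ℝ)) := by
  unfold kummerF
  congr 1
  ext n
  have h1 : (ascPochhammer ℝ n).eval 1 = (n.factorial : ℝ) := by
    rw [ascPochhammer_eval_one]
  rw [h1, ascPochhammer_eval_neg_div_factorial, neg_pow x n]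
  have : ((-1 : ℝ) ^ n) * (-1) ^ n = 1 := by rw [← mul_pow]; simp
  linear_combination (Ring.choose a n * (x ^ n / (n.factorial : ℝ))) * this

theorem succ_mul_choose_succ (a : ℝ) (n : ℕ) :
    ((n : ℝ) + 1) * Ring.choose a (n + 1) = Ring.choose a n * (a - n) := by
  have h := Ring.choose_smul_choose a (n := n + 1) (k := n) (by omega)
  simpa [Ring.choose_one_right] using h

/-- The ratio (a − n)/(n + 1) of consecutive coefficients has modulus at most 1. The Kummer series
is therefore dominated by the exponential series. -/
theorem abs_choose_le_one {a : ℝ} (ha₁ : -1 ≤ a) (ha₂ : a ≤ 1) (n : ℕ) :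
    |Ring.choose a n| ≤ 1 := by
  induction n with
  | zero => simp
  | succ n ih =>
    have h := congrArg abs (succ_mul_choose_succ a n)
    rw [abs_mul, abs_mul, abs_of_nonneg (by positivity : (0 : ℝ) ≤ n + 1)] at h
    have h3 : |a - n| ≤ n + 1 := by
      have := Nat.cast_nonneg (α := ℝ) n
      rw [abs_le]; constructor <;> linarith
    have h4 : ((n : ℝ) + 1) * |Ring.choose a (n + 1)| ≤ ((n : ℝ) + 1) * 1 := by
      rw [h]
      nlinarith [abs_nonneg (Ring.choose a n), abs_nonneg (a - n)]
    exact le_of_mul_le_mul_left h4 (by positivity)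

/-- Vandermonde's identity, with n!/(i! j!) for the integer binomial coefficient: these are the
Cauchy product coefficients of the Kummer series with the exponential series. -/
theorem choose_add_self_eq (a : ℝ) (n : ℕ) :
    Ring.choose ((n : ℝ) + a) n / (n.factorial : ℝ) =
      ∑ ij ∈ Finset.HasAntidiagonal.antidiagonal n,
        Ring.choose a ij.1 * (1 / (ij.1.factorial : ℝ)) * (1 / (ij.2.factorial : ℝ)) := by
  rw [add_comm, Ring.add_choose_eq n (Commute.all a (n : ℝ)), Finset.sum_div]
  refine Finset.sum_congr rfl fun ij hij => ?_
  rw [Finset.HasAntidiagonal.mem_antidiagonal] at hij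
  rw [Ring.choose_natCast, ← hij, ← Nat.choose_symm_add, Nat.cast_add_choose]
  field_simp

/-- Kummer's transformation of `₁F₁(-a, 1; -x)`. -/
theorem kummerF_neg_one_eq_exp_mul {a : ℝ} (ha₁ : -1 ≤ a) (ha₂ : a ≤ 1) (x : ℝ) :
    HasSum (fun n : ℕ => Real.exp (-x) * (Ring.choose ((n : ℝ) + a) n *
      (x ^ n / (n.factorial : ℝ)))) (kummerF (-a) 1 (-x)) := by
  have hs : Summable fun n : ℕ => ‖Ring.choose a n * (x ^ n / (n.factorial : ℝ))‖ := by
    refine Summable.of_nonneg_of_le (fun _ => norm_nonneg _) (fun n => ?_)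
      (Real.summable_pow_div_factorial |x|)
    rw [norm_mul, Real.norm_eq_abs, Real.norm_eq_abs, abs_div, abs_pow, Nat.abs_cast]
    exact mul_le_of_le_one_left (by positivity) (abs_choose_le_one ha₁ ha₂ n)
  have he : Summable fun n : ℕ => ‖x ^ n / (n.factorial : ℝ)‖ :=
    (Real.summable_pow_div_factorial x).norm
  have hprod := tsum_mul_tsum_eq_tsum_sum_antidiagonal_of_summable_norm hs he
  have hsum := (summable_norm_sum_mul_antidiagonal_of_summable_norm hs he).of_norm
  have hterm : ∀ n : ℕ, (∑ ij ∈ Finset.HasAntidiagonal.antidiagonal n,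
      Ring.choose a ij.1 * (x ^ ij.1 / (ij.1.factorial : ℝ)) *
        (x ^ ij.2 / (ij.2.factorial : ℝ))) =
      Ring.choose ((n : ℝ) + a) n * (x ^ n / (n.factorial : ℝ)) := by
    intro n
    have := choose_add_self_eq a n
    rw [mul_div_assoc', mul_div_right_comm, this, Finset.sum_mul]
    refine Finset.sum_congr rfl fun ij hij => ?_
    rw [Finset.HasAntidiagonal.mem_antidiagonal] at hij
    rw [← hij, pow_add]
    field_simp
  simp only [hterm] at hprod hsum
  have hexp : ∑' n : ℕ, x ^ n / (n.factorial : ℝ) = Real.exp x := by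
    rw [Real.exp_eq_exp_ℝ, NormedSpace.exp_eq_tsum_div]
  rw [hexp, ← kummerF_neg_one_eq_tsum] at hprod
  have h := hsum.hasSum.mul_left (Real.exp (-x))
  rwa [← hprod, mul_left_comm, ← Real.exp_add, neg_add_cancel, Real.exp_zero, mul_one] at h

/-- Up to the factor n! this is the product (a + 1)(a + 2)⋯(a + n). -/
theorem choose_add_self_nonneg {a : ℝ} (ha : -1 ≤ a) (n : ℕ) :
    0 ≤ Ring.choose ((n : ℝ) + a) n := by
  have h := Ring.descPochhammer_eq_factorial_smul_choose ((n : ℝ) + a) n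
  rw [nsmul_eq_mul, Polynomial.descPochhammer_smeval_eq_ascPochhammer,
    Polynomial.ascPochhammer_smeval_cast, Polynomial.ascPochhammer_smeval_eq_eval] at h
  have h2 : 0 ≤ (ascPochhammer ℝ n).eval ((n : ℝ) + a - n + 1) := by
    rw [add_sub_cancel_left]
    generalize n = m
    induction m with
    | zero => simp
    | succ m ih =>
      rw [ascPochhammer_succ_eval]
      have := Nat.cast_nonneg (α := ℝ) m
      exact mul_nonneg ih (by linarith)
  rw [h] at h2
  exact nonneg_of_mul_nonneg_right h2 (by positivity)

theorem hasSum_choose_add_self (a : ℝ) {w : ℝ} (hw₀ : 0 ≤ w) (hw₁ : w < 1) :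
    HasSum (fun n : ℕ => Ring.choose ((n : ℝ) + a) n * w ^ n) (1 / (1 - w) ^ (1 + a)) := by
  have h := (Real.one_div_one_sub_rpow_hasFPowerSeriesOnBall_zero (1 + a)).hasSum (y := w) (by
    simp [Metric.mem_eball, edist_dist, abs_of_nonneg hw₀, hw₁])
  rw [zero_add] at h
  have hterm : ∀ n : ℕ, (FormalMultilinearSeries.ofScalars ℝ
      (fun n : ℕ => Ring.choose (1 + a + (n : ℝ) - 1) n) n fun _ => w) =
      Ring.choose ((n : ℝ) + a) n * w ^ n := by
    intro n
    rw [show (n : ℝ) + a = 1 + a + n - 1 by ring]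
    simp [FormalMultilinearSeries.ofScalars]
  simpa only [hterm] using h

theorem integral_pow_mul_exp_neg {c : ℝ} (hc : 0 < c) (n : ℕ) :
    ∫ t in Ioi (0 : ℝ), t ^ n * Real.exp (-(c * t)) = (n.factorial : ℝ) / c ^ (n + 1) := by
  have h := Real.integral_rpow_mul_exp_neg_mul_Ioi (a := (n : ℝ) + 1) (r := c) (by positivity) hc
  rw [Real.Gamma_nat_eq_factorial, ← Nat.cast_succ, Real.rpow_natCast] at h
  simp only [Nat.cast_succ, add_sub_cancel_right, Real.rpow_natCast] at h
  rw [h, one_div, inv_pow]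
  field_simp

theorem integrableOn_pow_mul_exp_neg {c : ℝ} (hc : 0 < c) (n : ℕ) :
    IntegrableOn (fun t : ℝ => t ^ n * Real.exp (-(c * t))) (Ioi 0) := by
  -- A non-integrable function has integral 0 by convention, but the value computed above is
  -- positive.
  by_contra h
  have := integral_undef h
  rw [integral_pow_mul_exp_neg hc n] at this
  have : 0 < (n.factorial : ℝ) / c ^ (n + 1) := by positivity
  linarith

/-- After Kummer's transformation all terms are nonnegative, so termwise integration is legitimate
for every p > 0, and a negative binomial series in Ω/(p + Ω) < 1 results. The original series would
give powers of Ω/p, which are of no use for p < Ω. -/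
theorem laplaceTransform_kummerF {a Ω p : ℝ} (ha₁ : -1 ≤ a) (ha₂ : a ≤ 1) (hΩ : 0 < Ω)
    (hp : 0 < p) :
    laplaceTransform (fun t => kummerF (-a) 1 (-(Ω * t))) p = (1 + Ω / p) ^ a / p := by
  unfold laplaceTransform
  set F : ℕ → ℝ → ℝ := fun n t => Ring.choose ((n : ℝ) + a) n * Ω ^ n / (n.factorial : ℝ) *
    (t ^ n * Real.exp (-((p + Ω) * t))) with hF
  have hq : 0 < p + Ω := by positivity
  have hFint : ∀ n, IntegrableOn (F n) (Ioi 0) := fun n =>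
    (integrableOn_pow_mul_exp_neg hq n).const_mul _
  have hFval : ∀ n, ∫ t in Ioi (0 : ℝ), F n t =
      (Ring.choose ((n : ℝ) + a) n * (Ω / (p + Ω)) ^ n) * (1 / (p + Ω)) := by
    intro n
    simp only [hF]
    rw [integral_const_mul, integral_pow_mul_exp_neg hq, div_pow, pow_succ]
    field_simp
  have hFnn : ∀ n, ∀ t ∈ Ioi (0 : ℝ), 0 ≤ F n t := by
    intro n t ht
    have := choose_add_self_nonneg ha₁ n
    have ht : 0 < t := ht
    simp only [hF]
    positivity
  have hb := (hasSum_choose_add_self a (w := Ω / (p + Ω)) (by positivity)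
    (by rw [div_lt_one hq]; linarith)).mul_right (1 / (p + Ω))
  have hnorm : ∀ n, ∫ t in Ioi (0 : ℝ), ‖F n t‖ = ∫ t in Ioi (0 : ℝ), F n t := fun n =>
    setIntegral_congr_fun measurableSet_Ioi fun t ht => by
      simp only [Real.norm_of_nonneg (hFnn n t ht)]
  have hsum := hasSum_integral_of_summable_integral_norm (μ := volume.restrict (Ioi (0 : ℝ))) hFint
    (by simp only [hnorm, hFval]; exact hb.summable)
  have hpt : ∀ t : ℝ, ∑' n, F n t = Real.exp (-(p * t)) * kummerF (-a) 1 (-(Ω * t)) := by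
    intro t
    have h := (kummerF_neg_one_eq_exp_mul ha₁ ha₂ (Ω * t)).mul_left (Real.exp (-(p * t)))
    rw [← h.tsum_eq]
    congr 1
    ext n
    simp only [hF]
    rw [show -((p + Ω) * t) = -(p * t) + -(Ω * t) by ring, Real.exp_add, mul_pow]
    ring
  simp only [hpt, hFval] at hsum
  rw [hsum.unique hb]
  have h1 : 1 - Ω / (p + Ω) = p / (p + Ω) := by field_simp; ring
  have h2 : 1 + Ω / p = (p / (p + Ω))⁻¹ := by field_simp
  rw [h1, h2, Real.inv_rpow (by positivity), Real.rpow_add (by positivity), Real.rpow_one]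
  field_simp

theorem integral_exp_neg_mul_Ioi {c : ℝ} (hc : 0 < c) :
    ∫ t in Ioi (0 : ℝ), Real.exp (-(c * t)) = 1 / c := by
  simpa using integral_pow_mul_exp_neg hc 0

theorem integrableOn_exp_neg_mul_Ioi {c : ℝ} (hc : 0 < c) :
    IntegrableOn (fun t : ℝ => Real.exp (-(c * t))) (Ioi 0) := by
  simpa using integrableOn_pow_mul_exp_neg hc 0

/-- Rescaling moves t from the limit of integration into the integrand, ready for Fubini. -/
theorem modExpIntegral_mul {Ω : ℝ} (hΩ : 0 < Ω) {t : ℝ} (ht : 0 < t) :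
    modExpIntegral (Ω * t) = ∫ s in Ioc (0 : ℝ) Ω, (1 - Real.exp (-(t * s))) / s := by
  unfold modExpIntegral
  rw [← intervalIntegral.integral_of_le hΩ.le]
  have h := intervalIntegral.integral_comp_mul_left
    (fun s => (1 - Real.exp (-s)) / s) ht.ne' (a := 0) (b := Ω)
  rw [mul_zero, mul_comm t Ω, smul_eq_mul, eq_inv_mul_iff_mul_eq₀ ht.ne',
    ← intervalIntegral.integral_const_mul] at h
  rw [← h]
  congr 1
  ext s
  rcases eq_or_ne s 0 with rfl | hs
  · simp
  · field_simp

/-- Fubini for a nonnegative integrand: the inner integral in t is 1/(p(p + s)), and integrating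
over 0 < s ≤ Ω produces the logarithm. -/
theorem laplaceTransform_modExpIntegral {Ω p : ℝ} (hΩ : 0 < Ω) (hp : 0 < p) :
    laplaceTransform (fun t => modExpIntegral (Ω * t)) p = Real.log (1 + Ω / p) / p := by
  unfold laplaceTransform
  set f : ℝ → ℝ → ℝ := fun t s => Real.exp (-(p * t)) * ((1 - Real.exp (-(t * s))) / s) with hf
  have h1 : ∫ t in Ioi (0 : ℝ), Real.exp (-(p * t)) * modExpIntegral (Ω * t) =
      ∫ t in Ioi (0 : ℝ), ∫ s in Ioc (0 : ℝ) Ω, f t s :=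
    setIntegral_congr_fun measurableSet_Ioi fun t ht => by
      simp only [hf]
      rw [modExpIntegral_mul hΩ ht, integral_const_mul]
  have hfs : ∀ s t : ℝ, f t s = (Real.exp (-(p * t)) - Real.exp (-((p + s) * t))) / s := by
    intro s t
    simp only [hf]
    rw [show -((p + s) * t) = -(p * t) + -(t * s) by ring, Real.exp_add]
    ring
  have hint : ∀ s ∈ Ioc (0 : ℝ) Ω, IntegrableOn (fun t => f t s) (Ioi 0) := by
    intro s hs
    simp only [hfs]
    exact ((integrableOn_exp_neg_mul_Ioi hp).sub
      (integrableOn_exp_neg_mul_Ioi (add_pos hp hs.1))).div_const _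
  have hval : ∀ s ∈ Ioc (0 : ℝ) Ω, ∫ t in Ioi (0 : ℝ), f t s = (1 / p) * (1 / (p + s)) := by
    intro s hs
    have hps := add_pos hp hs.1
    have hs0 : s ≠ 0 := hs.1.ne'
    simp only [hfs]
    rw [integral_div, integral_sub (integrableOn_exp_neg_mul_Ioi hp)
      (integrableOn_exp_neg_mul_Ioi hps), integral_exp_neg_mul_Ioi hp,
      integral_exp_neg_mul_Ioi hps]
    field_simp
    ring
  have hnn : ∀ s ∈ Ioc (0 : ℝ) Ω, ∀ t ∈ Ioi (0 : ℝ), 0 ≤ f t s := by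
    intro s hs t ht
    have : Real.exp (-(t * s)) ≤ 1 :=
      Real.exp_le_one_iff.2 (neg_nonpos.2 (mul_pos ht hs.1).le)
    exact mul_nonneg (Real.exp_pos _).le (div_nonneg (by linarith) hs.1.le)
  have hcont : ContinuousOn (fun s : ℝ => (1 / p) * (1 / (p + s))) (Icc 0 Ω) := by
    refine continuousOn_const.mul (continuousOn_const.div (by fun_prop) fun s hs => ?_)
    have := hs.1
    positivity
  have hmeas : AEStronglyMeasurable (Function.uncurry f)
      ((volume.restrict (Ioi (0 : ℝ))).prod (volume.restrict (Ioc (0 : ℝ) Ω))) := by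
    apply Measurable.aestronglyMeasurable
    simp only [hf, Function.uncurry_def]
    fun_prop
  have hprod : Integrable (Function.uncurry f)
      ((volume.restrict (Ioi (0 : ℝ))).prod (volume.restrict (Ioc (0 : ℝ) Ω))) := by
    rw [integrable_prod_iff' hmeas]
    refine ⟨(ae_restrict_iff' measurableSet_Ioc).2 (Eventually.of_forall hint), ?_⟩
    have : IntegrableOn (fun s : ℝ => (1 / p) * (1 / (p + s))) (Ioc 0 Ω) :=
      hcont.integrableOn_Icc.mono_set Ioc_subset_Icc_self
    refine this.congr ((ae_restrict_iff' measurableSet_Ioc).2 (Eventually.of_forall fun s hs => ?_))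
    refine (hval s hs).symm.trans ?_
    exact setIntegral_congr_fun measurableSet_Ioi fun t ht =>
      (Real.norm_of_nonneg (hnn s hs t ht)).symm
  rw [h1, integral_integral_swap hprod, setIntegral_congr_fun measurableSet_Ioc hval,
    integral_const_mul, ← intervalIntegral.integral_of_le hΩ.le,
    intervalIntegral.integral_comp_add_left (fun s => 1 / s), add_zero,
    integral_one_div_of_pos hp (by positivity)]
  rw [show (p + Ω) / p = 1 + Ω / p by field_simp]
  ring

/-- A nonzero Bochner integral forces integrability, so `hf` stands in for an integrability
hypothesis. -/
theorem laplaceTransform_const_add_mul (f : ℝ → ℝ) (a b : ℝ) {p : ℝ} (hp : 0 < p)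
    (hf : laplaceTransform f p ≠ 0) :
    laplaceTransform (fun t => a + b * f t) p = a / p + b * laplaceTransform f p := by
  have hint : IntegrableOn (fun t => Real.exp (-(p * t)) * f t) (Ioi 0) :=
    Integrable.of_integral_ne_zero hf
  unfold laplaceTransform
  have : ∀ t, Real.exp (-(p * t)) * (a + b * f t) =
      Real.exp (-(p * t)) * a + b * (Real.exp (-(p * t)) * f t) := fun t => by ring
  simp only [this]
  rw [integral_add ((integrableOn_exp_neg_mul_Ioi hp).mul_const _) (hint.const_mul _),
    integral_mul_const, integral_const_mul, integral_exp_neg_mul_Ioi hp]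
  ring

theorem mul_laplaceTransform_creep_of_eq_zero (J₀ M₀ : ℝ) {Ω p : ℝ} (hΩ : 0 < Ω) (hp : 0 < p) :
    p * laplaceTransform (strickMainardiCreep J₀ M₀ Ω 0) p =
      J₀ + M₀ * Real.log (1 + Ω / p) := by
  have hlog : 0 < Real.log (1 + Ω / p) := Real.log_pos (by have := div_pos hΩ hp; linarith)
  have h := laplaceTransform_const_add_mul (fun t => modExpIntegral (Ω * t)) J₀ M₀ hp
    (by rw [laplaceTransform_modExpIntegral hΩ hp]; positivity)
  have h2 : strickMainardiCreep J₀ M₀ Ω 0 = fun t => J₀ + M₀ * modExpIntegral (Ω * t) := by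
    ext t
    simp [strickMainardiCreep]
  rw [h2, h, laplaceTransform_modExpIntegral hΩ hp]
  field_simp

theorem mul_laplaceTransform_creep_of_ne_zero (J₀ M₀ : ℝ) {Ω α p : ℝ} (hΩ : 0 < Ω)
    (hα₁ : -1 < α) (hα₂ : α < 1) (hα : α ≠ 0) (hp : 0 < p) :
    p * laplaceTransform (strickMainardiCreep J₀ M₀ Ω α) p =
      J₀ + M₀ / α * ((1 + Ω / p) ^ α - 1) := by
  have h := laplaceTransform_const_add_mul (fun t => kummerF (-α) 1 (-(Ω * t))) (J₀ - M₀ / α)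
    (M₀ / α) hp (by rw [laplaceTransform_kummerF hα₁.le hα₂.le hΩ hp]; positivity)
  have h2 : strickMainardiCreep J₀ M₀ Ω α =
      fun t => J₀ - M₀ / α + M₀ / α * kummerF (-α) 1 (-(Ω * t)) := by
    ext t
    simp only [strickMainardiCreep, if_neg hα]
    ring
  rw [h2, h, laplaceTransform_kummerF hα₁.le hα₂.le hΩ hp]
  field_simp
  ring

/-! ### The function of w on the closed upper half-plane -/

/-- The Strick-Mainardi function `p J~(p)` in terms of the variable `w = 1 + Ω / p`. -/
noncomputable def carsonOf (J₀ M₀ α : ℝ) (w : ℂ) : ℂ :=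
  if α = 0 then J₀ + M₀ * Complex.log w else J₀ + M₀ / α * (w ^ (α : ℂ) - 1)

theorem strickMainardiCarson_eq (J₀ M₀ Ω α : ℝ) (p : ℂ) :
    strickMainardiCarson J₀ M₀ Ω α p = carsonOf J₀ M₀ α (1 + Ω / p) := rfl

theorem cpow_half_im_nonneg {z : ℂ} (hz : 0 ≤ z.im) : 0 ≤ (z ^ (1 / 2 : ℂ)).im := by
  have h : (1 / 2 : ℂ) = ((1 / 2 : ℝ) : ℂ) := by push_cast; rfl
  rw [h, Complex.cpow_ofReal_im]
  have h0 := Complex.arg_nonneg_iff.2 hz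
  have h1 := Complex.arg_le_pi z
  exact mul_nonneg (by positivity)
    (Real.sin_nonneg_of_nonneg_of_le_pi (by linarith) (by linarith))

/-- The principal argument is π on the negative half-axis, hence continuous from above there.
Approaching the cut of p from below means approaching that of w from above. -/
theorem continuousWithinAt_log_upper {w : ℂ} (hw : w ≠ 0) :
    ContinuousWithinAt Complex.log {z : ℂ | 0 ≤ z.im} w := by
  by_cases h : w ∈ Complex.slitPlane
  · exact (continuousAt_clog h).continuousWithinAt
  · rw [Complex.mem_slitPlane_iff, not_or, not_lt, not_not] at h
    refine Complex.continuousWithinAt_log_of_re_neg_of_im_zero (lt_of_le_of_ne h.1 fun h0 => ?_) h.2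
    exact hw (Complex.ext h0 h.2)

theorem continuousWithinAt_cpow_upper {w : ℂ} (hw : w ≠ 0) (a : ℂ) :
    ContinuousWithinAt (fun z : ℂ => z ^ a) {z : ℂ | 0 ≤ z.im} w := by
  have h : ContinuousWithinAt (fun z : ℂ => Complex.exp (Complex.log z * a))
      {z : ℂ | 0 ≤ z.im} w :=
    ((continuousWithinAt_log_upper hw).mul continuousWithinAt_const).cexp
  refine h.congr_of_eventuallyEq ?_ (Complex.cpow_def_of_ne_zero hw a)
  filter_upwards [mem_nhdsWithin_of_mem_nhds (isOpen_ne.mem_nhds hw)] with z hz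
  exact Complex.cpow_def_of_ne_zero hz a

theorem norm_cpow_half (z : ℂ) : ‖z ^ (1 / 2 : ℂ)‖ = √‖z‖ := by
  have h : (1 / 2 : ℂ) = ((1 / 2 : ℝ) : ℂ) := by push_cast; rfl
  rw [h, Complex.norm_cpow_real, Real.sqrt_eq_rpow]

/-- The point 0 has to be included, since p J~(p) may vanish at a real boundary point with 0 < w <
1. There, continuity follows from the modulus √‖z‖. -/
theorem continuousWithinAt_cpow_half_upper (w : ℂ) :
    ContinuousWithinAt (fun z : ℂ => z ^ (1 / 2 : ℂ)) {z : ℂ | 0 ≤ z.im} w := by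
  rcases eq_or_ne w 0 with rfl | hw
  · have h : Tendsto (fun z : ℂ => ‖z ^ (1 / 2 : ℂ)‖) (𝓝 0) (𝓝 0) := by
      simp only [norm_cpow_half]
      have : Continuous fun z : ℂ => √‖z‖ := by fun_prop
      simpa using this.tendsto 0
    have h2 := tendsto_zero_iff_norm_tendsto_zero.2 h
    have h3 : ContinuousAt (fun z : ℂ => z ^ (1 / 2 : ℂ)) 0 := by
      unfold ContinuousAt
      simpa using h2
    exact h3.continuousWithinAt
  · exact continuousWithinAt_cpow_upper hw _

/-- Since |θα| < π, a nonzero sin(θα) has the sign of α. This is how |α| < 1 makes the half-plane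
invariant. -/
theorem sin_mul_div_nonneg {α θ : ℝ} (hα₁ : -1 < α) (hα₂ : α < 1) (hθ₀ : 0 ≤ θ)
    (hθ₁ : θ ≤ Real.pi) : 0 ≤ Real.sin (θ * α) / α := by
  rcases le_total 0 α with h | h
  · exact div_nonneg (Real.sin_nonneg_of_nonneg_of_le_pi (by positivity) (by nlinarith)) h
  · refine div_nonneg_of_nonpos ?_ h
    exact Real.sin_nonpos_of_nonpos_of_neg_pi_le (by nlinarith) (by nlinarith)

theorem sin_mul_div_pos {α θ : ℝ} (hα₁ : -1 < α) (hα₂ : α < 1) (hα : α ≠ 0) (hθ₀ : 0 < θ)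
    (hθ₁ : θ ≤ Real.pi) : 0 < Real.sin (θ * α) / α := by
  rcases lt_or_gt_of_ne hα with h | h
  · refine div_pos_of_neg_of_neg ?_ h
    exact Real.sin_neg_of_neg_of_neg_pi_lt (by nlinarith) (by nlinarith)
  · exact div_pos (Real.sin_pos_of_pos_of_lt_pi (by positivity) (by nlinarith)) h

theorem carsonOf_im_of_ne_zero (J₀ M₀ : ℝ) {α : ℝ} (hα : α ≠ 0) (w : ℂ) :
    (carsonOf J₀ M₀ α w).im = M₀ * (‖w‖ ^ α * (Real.sin (Complex.arg w * α) / α)) := by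
  rw [carsonOf, if_neg hα]
  have h : (M₀ / α : ℂ) = ((M₀ / α : ℝ) : ℂ) := by push_cast; rfl
  rw [h, Complex.add_im, Complex.ofReal_im, Complex.im_ofReal_mul, Complex.sub_im,
    Complex.cpow_ofReal_im, Complex.one_im]
  ring

theorem carsonOf_zero_im (J₀ M₀ : ℝ) (w : ℂ) : (carsonOf J₀ M₀ 0 w).im = M₀ * Complex.arg w := by
  rw [carsonOf, if_pos rfl, Complex.add_im, Complex.ofReal_im, Complex.im_ofReal_mul,
    Complex.log_im, zero_add]

section

variable {J₀ M₀ α : ℝ}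

theorem carsonOf_im_nonneg (hM₀ : 0 < M₀) (hα₁ : -1 < α) (hα₂ : α < 1) {w : ℂ} (hw : 0 ≤ w.im) :
    0 ≤ (carsonOf J₀ M₀ α w).im := by
  have h0 := Complex.arg_nonneg_iff.2 hw
  rcases eq_or_ne α 0 with rfl | hα
  · rw [carsonOf_zero_im]; positivity
  · rw [carsonOf_im_of_ne_zero _ _ hα]
    have := sin_mul_div_nonneg hα₁ hα₂ h0 (Complex.arg_le_pi w)
    positivity

/-- Strictness keeps the value off the cut of the square root, which is what analyticity of the root
needs. -/
theorem carsonOf_im_pos (hM₀ : 0 < M₀) (hα₁ : -1 < α) (hα₂ : α < 1) {w : ℂ} (hw : 0 < w.im) :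
    0 < (carsonOf J₀ M₀ α w).im := by
  have h0 : 0 < Complex.arg w := by
    refine lt_of_le_of_ne (Complex.arg_nonneg_iff.2 hw.le) fun h => ?_
    have := (Complex.arg_eq_zero_iff.1 h.symm).2
    linarith
  have hw0 : 0 < ‖w‖ := norm_pos_iff.2 fun h => by simp [h] at hw
  rcases eq_or_ne α 0 with rfl | hα
  · rw [carsonOf_zero_im]; positivity
  · rw [carsonOf_im_of_ne_zero _ _ hα]
    have := sin_mul_div_pos hα₁ hα₂ hα h0 (Complex.arg_le_pi w)
    positivity

theorem continuousWithinAt_carsonOf {w : ℂ} (hw : w ≠ 0) :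
    ContinuousWithinAt (carsonOf J₀ M₀ α) {z : ℂ | 0 ≤ z.im} w := by
  unfold carsonOf
  split_ifs with h
  · exact continuousWithinAt_const.add
      (continuousWithinAt_const.mul (continuousWithinAt_log_upper hw))
  · exact continuousWithinAt_const.add (continuousWithinAt_const.mul
      ((continuousWithinAt_cpow_upper hw _).sub continuousWithinAt_const))

theorem differentiableAt_carsonOf {w : ℂ} (hw : w ∈ Complex.slitPlane) :
    DifferentiableAt ℂ (carsonOf J₀ M₀ α) w := by
  unfold carsonOf
  split_ifs with h
  · exact ((differentiableAt_id.clog hw).const_mul _).const_add _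
  · exact (((differentiableAt_id.cpow_const hw).sub_const _).const_mul _).const_add _

theorem carsonOf_ofReal (w : ℝ) (hw : 0 ≤ w) : carsonOf J₀ M₀ α (w : ℂ) =
    ((if α = 0 then J₀ + M₀ * Real.log w else J₀ + M₀ / α * (w ^ α - 1) : ℝ) : ℂ) := by
  unfold carsonOf
  split_ifs with h
  · push_cast [Complex.ofReal_log hw]; rfl
  · push_cast [Complex.ofReal_cpow hw]; rfl

theorem carsonOf_one : carsonOf J₀ M₀ α 1 = J₀ := by
  simp [carsonOf]

end

theorem rpow_le_one_add_rpow_add {x a : ℝ} (hx : 0 < x) : x ^ a ≤ x ^ |a| + x ^ (-|a|) := by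
  rcases abs_choice a with h | h
  · rw [h]; have := Real.rpow_pos_of_pos hx (-a); linarith
  · rw [h, neg_neg]; have := Real.rpow_pos_of_pos hx (-a); linarith

/-- An exponent below 1 makes the singularities at w = ∞ and w = 0 locally integrable along the real
p-axis. It is |α|, or 1/2 for the logarithm, where any exponent in ]0,1[ would serve. -/
theorem exists_norm_carsonOf_le (J₀ M₀ : ℝ) {α : ℝ} (hα₁ : -1 < α) (hα₂ : α < 1) :
    ∃ a C : ℝ, 0 < a ∧ a < 1 ∧ 0 < C ∧ ∀ w : ℂ, w ≠ 0 →
      ‖carsonOf J₀ M₀ α w‖ ≤ C * (1 + ‖w‖ ^ a + ‖w‖ ^ (-a)) := by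
  rcases eq_or_ne α 0 with rfl | hα
  · refine ⟨1 / 2, |J₀| + |M₀| * 4 + 1, by norm_num, by norm_num, by positivity, fun w hw => ?_⟩
    have hw0 : 0 < ‖w‖ := norm_pos_iff.2 hw
    have h1 : ‖Complex.log w‖ ≤ |Real.log ‖w‖| + |Complex.arg w| := by
      rw [← Complex.log_re, ← Complex.log_im]
      exact Complex.norm_le_abs_re_add_abs_im _
    have h2 := (Complex.abs_arg_le_pi w).trans Real.pi_le_four
    have h3 : |Real.log ‖w‖| ≤ 2 * (‖w‖ ^ (1 / 2 : ℝ) + ‖w‖ ^ (-(1 / 2) : ℝ)) := by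
      have ha := Real.log_le_rpow_div hw0.le (ε := 1 / 2) (by norm_num)
      have hb := Real.log_le_rpow_div (inv_nonneg.2 hw0.le) (ε := 1 / 2) (by norm_num)
      rw [Real.log_inv, Real.inv_rpow hw0.le, ← Real.rpow_neg hw0.le] at hb
      have hc := Real.rpow_pos_of_pos hw0 (1 / 2)
      have hd := Real.rpow_pos_of_pos hw0 (-(1 / 2))
      rw [abs_le]
      constructor <;> linarith
    have hc := Real.rpow_pos_of_pos hw0 (1 / 2)
    have hd := Real.rpow_pos_of_pos hw0 (-(1 / 2))
    rw [carsonOf, if_pos rfl]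
    refine (norm_add_le _ _).trans ?_
    rw [norm_mul, Complex.norm_real, Complex.norm_real, Real.norm_eq_abs, Real.norm_eq_abs]
    have h4 : ‖Complex.log w‖ ≤ 4 * (1 + ‖w‖ ^ (1 / 2 : ℝ) + ‖w‖ ^ (-(1 / 2) : ℝ)) := by linarith
    have h5 := mul_le_mul_of_nonneg_left h4 (abs_nonneg M₀)
    have h6 := mul_nonneg (abs_nonneg J₀)
      (by positivity : 0 ≤ ‖w‖ ^ (1 / 2 : ℝ) + ‖w‖ ^ (-(1 / 2) : ℝ))
    linarith
  · refine ⟨|α|, |J₀| + |M₀ / α| * 2 + 1, abs_pos.2 hα, abs_lt.2 ⟨hα₁, hα₂⟩, by positivity,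
      fun w hw => ?_⟩
    have hw0 : 0 < ‖w‖ := norm_pos_iff.2 hw
    have hc := Real.rpow_pos_of_pos hw0 |α|
    have hd := Real.rpow_pos_of_pos hw0 (-|α|)
    have h1 : ‖w ^ (α : ℂ) - 1‖ ≤ 1 + ‖w‖ ^ |α| + ‖w‖ ^ (-|α|) := by
      refine (norm_sub_le _ _).trans ?_
      rw [Complex.norm_cpow_real, norm_one]
      have := rpow_le_one_add_rpow_add (a := α) hw0
      linarith
    rw [carsonOf, if_neg hα]
    refine (norm_add_le _ _).trans ?_
    rw [norm_mul, Complex.norm_real, ← Complex.ofReal_div, Complex.norm_real, Real.norm_eq_abs,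
      Real.norm_eq_abs]
    have h5 := mul_le_mul_of_nonneg_left h1 (abs_nonneg (M₀ / α))
    have h6 := mul_nonneg (abs_nonneg J₀) (by positivity : 0 ≤ ‖w‖ ^ |α| + ‖w‖ ^ (-|α|))
    have h7 := mul_nonneg (abs_nonneg (M₀ / α))
      (by positivity : 0 ≤ 1 + ‖w‖ ^ |α| + ‖w‖ ^ (-|α|))
    linarith

theorem one_add_rpow_le {u a : ℝ} (hu : 0 ≤ u) (ha₀ : 0 < a) (ha₁ : a < 1) :
    (1 + u) ^ a ≤ 1 + u ^ a := by
  simpa using Real.rpow_add_le_add_rpow zero_le_one hu ha₀.le ha₁.le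

/-! ### Cauchy's theorem and Stieltjes inversion in the lower half-plane -/

section HalfPlane

variable {G : ℂ → ℂ} {K R : ℝ}

theorem continuous_horizontal (hG : DifferentiableOn ℂ G {z | z.im < 0}) {y : ℝ} (hy : y < 0) :
    Continuous fun x : ℝ => G (x + y * Complex.I) := by
  refine hG.continuousOn.comp_continuous (by fun_prop) fun x => ?_
  simpa using hy

theorem sq_add_sq_eq_norm_sq (x y : ℝ) : ‖(x + y * Complex.I : ℂ)‖ ^ 2 = x ^ 2 + y ^ 2 := by
  rw [← Complex.normSq_eq_norm_sq, Complex.normSq_add_mul_I]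

theorem abs_le_norm_add_mul_I (x y : ℝ) : |x| ≤ ‖(x + y * Complex.I : ℂ)‖ := by
  simpa using Complex.abs_re_le_norm (x + y * Complex.I : ℂ)

theorem abs_le_norm_add_mul_I' (x y : ℝ) : |y| ≤ ‖(x + y * Complex.I : ℂ)‖ := by
  simpa using Complex.abs_im_le_norm (x + y * Complex.I : ℂ)

theorem integrable_horizontal (hG : DifferentiableOn ℂ G {z | z.im < 0})
    (hdec : ∀ z : ℂ, z.im < 0 → R ≤ ‖z‖ → ‖G z‖ ≤ K / ‖z‖ ^ 2) {y : ℝ} (hy : y < 0) :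
    Integrable fun x : ℝ => G (x + y * Complex.I) := by
  refine (continuous_horizontal hG hy).locallyIntegrable.integrable_of_isBigO_cocompact
    (g := fun x : ℝ => (1 + x ^ 2)⁻¹) ?_ (integrable_inv_one_add_sq.integrableAtFilter _)
  refine IsBigO.of_bound (2 * |K|) ?_
  have : ∀ᶠ x : ℝ in cocompact ℝ, max R 1 ≤ ‖x‖ :=
    tendsto_norm_cocompact_atTop.eventually_ge_atTop _
  filter_upwards [this] with x hx
  have h1 : R ≤ |x| := (le_max_left _ _).trans hx
  have h2 : 1 ≤ |x| := (le_max_right _ _).trans hx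
  have h3 : 1 ≤ x ^ 2 := by rw [← sq_abs]; nlinarith
  refine (hdec _ (by simpa using hy) (h1.trans (abs_le_norm_add_mul_I x y))).trans ?_
  rw [sq_add_sq_eq_norm_sq, Real.norm_of_nonneg (by positivity), ← div_eq_mul_inv,
    div_le_div_iff₀ (by positivity) (by positivity)]
  have h4 := le_abs_self K
  have h5 := abs_nonneg K
  nlinarith [sq_nonneg y, mul_nonneg h5 (sq_nonneg y), mul_nonneg h5 (by linarith : 0 ≤ x ^ 2 - 1),
    mul_nonneg (by linarith : 0 ≤ |K| - K) (by positivity : 0 ≤ 1 + x ^ 2)]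

/-- Cauchy's theorem on a rectangle of half-width T: the vertical sides have fixed length and G is
O(T⁻²) on them. -/
theorem integral_horizontal_eq (hG : DifferentiableOn ℂ G {z | z.im < 0})
    (hdec : ∀ z : ℂ, z.im < 0 → R ≤ ‖z‖ → ‖G z‖ ≤ K / ‖z‖ ^ 2) {y y' : ℝ} (hy : y < 0)
    (hy' : y' < 0) :
    ∫ x : ℝ, G (x + y' * Complex.I) = ∫ x : ℝ, G (x + y * Complex.I) := by
  have hrect : ∀ T : ℝ, (∫ x : ℝ in (-T)..T, G (x + y' * Complex.I)) -
      (∫ x : ℝ in (-T)..T, G (x + y * Complex.I)) +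
      Complex.I • (∫ s : ℝ in y'..y, G (T + s * Complex.I)) -
      Complex.I • (∫ s : ℝ in y'..y, G ((-T : ℝ) + s * Complex.I)) = 0 := by
    intro T
    have h := Complex.integral_boundary_rect_eq_zero_of_differentiableOn G
      (⟨-T, y'⟩ : ℂ) (⟨T, y⟩ : ℂ) (hG.mono fun z hz => ?_)
    · simpa using h
    · have h2 : z.im ∈ uIcc y' y := hz.2
      have := (mem_uIcc.1 h2)
      rcases this with h3 | h3 <;> simp only [mem_ofPred_eq] <;> linarith [h3.1, h3.2]
  -- The sign σ = ±1 treats both vertical sides at once.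
  have hside : ∀ σ : ℝ, |σ| = 1 →
      Tendsto (fun T : ℝ => ∫ s : ℝ in y'..y, G ((σ * T : ℝ) + s * Complex.I)) atTop (𝓝 0) := by
    intro σ hσ
    have hbound : ∀ᶠ T : ℝ in atTop,
        ‖∫ s : ℝ in y'..y, G ((σ * T : ℝ) + s * Complex.I)‖ ≤ |K| / T ^ 2 * |y - y'| := by
      filter_upwards [eventually_ge_atTop (max R 1)] with T hT
      have hT1 : 1 ≤ T := (le_max_right _ _).trans hT
      have habs : |σ * T| = T := by rw [abs_mul, hσ, one_mul, abs_of_nonneg (by linarith)]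
      refine intervalIntegral.norm_integral_le_of_norm_le_const fun s hs => ?_
      have hs0 : s < 0 := by
        rcases mem_uIoc.1 hs with h | h <;> linarith [h.1, h.2]
      have hn : T ≤ ‖((σ * T : ℝ) + s * Complex.I : ℂ)‖ :=
        habs.symm.le.trans (abs_le_norm_add_mul_I (σ * T) s)
      refine (hdec _ (by simpa using hs0) (((le_max_left _ _).trans hT).trans hn)).trans ?_
      exact div_le_div₀ (abs_nonneg _) (le_abs_self _) (by positivity)
        (pow_le_pow_left₀ (by linarith) hn 2)
    refine squeeze_zero_norm' hbound ?_
    have : Tendsto (fun T : ℝ => |K| / T ^ 2) atTop (𝓝 0) :=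
      Tendsto.div_atTop tendsto_const_nhds (tendsto_pow_atTop two_ne_zero)
    simpa using this.mul_const |y - y'|
  have h1 := intervalIntegral_tendsto_integral (integrable_horizontal hG hdec hy')
    tendsto_neg_atTop_atBot tendsto_id
  have h2 := intervalIntegral_tendsto_integral (integrable_horizontal hG hdec hy)
    tendsto_neg_atTop_atBot tendsto_id
  have h3 := (hside 1 (by simp)).const_smul Complex.I
  have h4 := (hside (-1) (by simp)).const_smul Complex.I
  have h5 := ((h1.sub h2).add h3).sub h4
  have h6 : Tendsto (fun _ : ℝ => (0 : ℂ)) atTop (𝓝 0) := tendsto_const_nhds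
  have h7 := tendsto_nhds_unique (h5.congr fun T => by
    have := hrect T
    simp only [one_mul, neg_mul, id] at *
    exact this) h6
  simpa [sub_eq_zero] using h7

/-- The integral does not depend on the height, and it tends to 0 as the line moves down to −i∞. -/
theorem integral_horizontal_eq_zero (hG : DifferentiableOn ℂ G {z | z.im < 0})
    (hdec : ∀ z : ℂ, z.im < 0 → R ≤ ‖z‖ → ‖G z‖ ≤ K / ‖z‖ ^ 2) {y : ℝ} (hy : y < 0) :
    ∫ x : ℝ, G (x + y * Complex.I) = 0 := by
  have hbound : ∀ᶠ y' : ℝ in atBot, ∀ x : ℝ,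
      ‖G (x + y' * Complex.I)‖ ≤ |K| * (x ^ 2 + y' ^ 2)⁻¹ := by
    filter_upwards [eventually_le_atBot (-max R 1)] with y' hy' x
    have h1 := le_max_left R 1
    have h2 := le_max_right R 1
    have h3 : |y'| = -y' := abs_of_neg (by linarith)
    have h4 := abs_le_norm_add_mul_I' x y'
    refine (hdec _ (by simp; linarith) (by linarith)).trans ?_
    rw [sq_add_sq_eq_norm_sq, div_eq_mul_inv]
    exact mul_le_mul_of_nonneg_right (le_abs_self _) (by positivity)
  have hlim : Tendsto (fun y' : ℝ => ∫ x : ℝ, G (x + y' * Complex.I)) atBot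
      (𝓝 (∫ _ : ℝ, (0 : ℂ))) := by
    refine tendsto_integral_filter_of_dominated_convergence
      (fun x : ℝ => |K| * (1 + x ^ 2)⁻¹) ?_ ?_ (integrable_inv_one_add_sq.const_mul _) ?_
    · filter_upwards [eventually_lt_atBot 0] with y' hy'
      exact (continuous_horizontal hG hy').aestronglyMeasurable
    · filter_upwards [hbound, eventually_le_atBot (-1)] with y' h hy'
      refine Eventually.of_forall fun x => (h x).trans ?_
      refine mul_le_mul_of_nonneg_left (inv_anti₀ (by positivity) ?_) (abs_nonneg _)
      nlinarith
    · refine Eventually.of_forall fun x => ?_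
      refine squeeze_zero_norm' (hbound.mono fun y' h => h x) ?_
      have h1 : Tendsto (fun y' : ℝ => x ^ 2 + y' ^ 2) atBot atTop :=
        tendsto_atTop_add_const_left _ _ (by
          simpa [Function.comp_def] using (tendsto_pow_atTop (α := ℝ) two_ne_zero).comp tendsto_neg_atBot_atTop)
      simpa using h1.inv_tendsto_atTop.const_mul |K|
  have hconst : Tendsto (fun y' : ℝ => ∫ x : ℝ, G (x + y' * Complex.I)) atBot
      (𝓝 (∫ x : ℝ, G (x + y * Complex.I))) := by
    refine tendsto_const_nhds.congr' ?_
    filter_upwards [eventually_lt_atBot 0] with y' hy'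
    exact integral_horizontal_eq hG hdec hy' hy
  simpa using tendsto_nhds_unique hconst hlim

/-- A function analytic in the lower half-plane, of order `z⁻²` at infinity and with dominated
boundary values, has an integrable boundary function of vanishing integral. -/
theorem integral_boundary_eq_zero (hG : DifferentiableOn ℂ G {z | z.im < 0})
    (hdec : ∀ z : ℂ, z.im < 0 → R ≤ ‖z‖ → ‖G z‖ ≤ K / ‖z‖ ^ 2) {g : ℝ → ℂ} {D : ℝ → ℝ} {δ : ℝ}
    (hδ : 0 < δ) (hD : Integrable D)
    (hbound : ∀ᵐ x : ℝ, ∀ y : ℝ, -δ < y → y < 0 → ‖G (x + y * Complex.I)‖ ≤ D x)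
    (hlim : ∀ᵐ x : ℝ, Tendsto (fun y : ℝ => G (x + y * Complex.I)) (𝓝[<] 0) (𝓝 (g x))) :
    Integrable g ∧ ∫ x, g x = 0 := by
  have hmem : ∀ᶠ y : ℝ in 𝓝[<] 0, -δ < y ∧ y < 0 := by
    filter_upwards [self_mem_nhdsWithin,
      mem_nhdsWithin_of_mem_nhds (Ioi_mem_nhds (neg_lt_zero.2 hδ))] with y h1 h2
    exact ⟨h2, h1⟩
  have hmeas : AEStronglyMeasurable g := by
    -- The approximating functions must be measurable for every y. The default 0 for y ≥ 0 is not
    -- seen by the limit.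
    refine aestronglyMeasurable_of_tendsto_ae (μ := volume) (g := g) (𝓝[<] (0 : ℝ))
      (f := fun (y x : ℝ) => if y < 0 then G (x + y * Complex.I) else 0) (fun y => ?_) ?_
    · split_ifs with h
      · exact (continuous_horizontal hG h).aestronglyMeasurable
      · exact aestronglyMeasurable_const
    · filter_upwards [hlim] with x hx
      refine hx.congr' ?_
      filter_upwards [hmem] with y hy
      rw [if_pos hy.2]
  have hgD : ∀ᵐ x : ℝ, ‖g x‖ ≤ D x := by
    filter_upwards [hbound, hlim] with x hb hl
    exact le_of_tendsto hl.norm (hmem.mono fun y hy => hb y hy.1 hy.2)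
  refine ⟨hD.mono' hmeas hgD, ?_⟩
  have h := tendsto_integral_filter_of_dominated_convergence (μ := volume) D
    (F := fun (y : ℝ) (x : ℝ) => G (x + y * Complex.I)) (l := 𝓝[<] (0 : ℝ)) (f := g) ?_ ?_ hD hlim
  · refine tendsto_nhds_unique (h.congr' ?_) tendsto_const_nhds
    filter_upwards [hmem] with y hy
    exact integral_horizontal_eq_zero hG hdec hy.2
  · filter_upwards [hmem] with y hy
    exact (continuous_horizontal hG hy.2).aestronglyMeasurable
  · filter_upwards [hmem] with y hy
    filter_upwards [hbound] with x hx
    exact hx y hy.1 hy.2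

end HalfPlane

theorem ofReal_sub_I_inv_im (x : ℝ) : ((1 : ℂ) / (x - Complex.I)).im = (1 + x ^ 2)⁻¹ := by
  rw [one_div, Complex.inv_im]
  simp [Complex.normSq_apply]
  ring

/-- Stieltjes inversion: a function analytic in the lower half-plane, real on the positive
half-axis, equal to a real constant up to `O(z⁻¹)` at infinity and with dominated boundary values,
is recovered on the positive half-axis from its imaginary part on the negative half-axis. -/
theorem stieltjes_representation {F : ℂ → ℂ} {c K R p : ℝ} (hp : 0 < p)
    (hF : DifferentiableOn ℂ F {z | z.im < 0}) (hFp : DifferentiableAt ℂ F p)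
    (hreal : ∀ x : ℝ, 0 < x → (F x).im = 0)
    (hdec : ∀ z : ℂ, R ≤ ‖z‖ → ‖F z - c‖ ≤ K / ‖z‖)
    {B : ℝ → ℝ} (hB : LocallyIntegrable B)
    (hbound : ∀ᵐ x : ℝ, ∀ y : ℝ, y < 0 → ‖F (x + y * Complex.I)‖ ≤ B x)
    (hlim : ∀ᵐ x : ℝ, Tendsto (fun y : ℝ => F (x + y * Complex.I)) (𝓝[<] 0) (𝓝 (F x))) :
    (F p).re = c + 1 / Real.pi * ∫ r in Ioi (0 : ℝ), (F (-(r : ℂ))).im / (p + r) := by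
  set A : ℂ := F p - c with hA
  -- The difference quotient stays bounded near p, but behaves like −A/z at infinity. The second
  -- term, with its pole outside the closed lower half-plane, cancels this and leaves O(z⁻²).
  set G : ℂ → ℂ := fun z => (F z - F p) / (z - p) + A / (z - Complex.I) with hGdef
  have hnep : ∀ z : ℂ, z.im < 0 → z - p ≠ 0 := fun z hz h => by
    have := congrArg Complex.im h
    simp at this
    linarith
  have hneI : ∀ z : ℂ, z.im ≤ 0 → z - Complex.I ≠ 0 := fun z hz h => by
    have := congrArg Complex.im h
    simp at this
    linarith
  have hG : DifferentiableOn ℂ G {z | z.im < 0} := by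
    refine ((hF.sub_const _).div (by fun_prop) fun z hz => hnep z hz).add
      ((differentiableOn_const _).div (by fun_prop) fun z hz => hneI z (le_of_lt hz))
  set R' : ℝ := max R (max (2 * p) 2) with hR'
  set K' : ℝ := (|K| + ‖A‖ * (1 + p)) * 4 with hK'
  have hR'1 : R ≤ R' := le_max_left _ _
  have hR'2 : 2 * p ≤ R' := (le_max_left _ _).trans (le_max_right _ _)
  have hR'3 : 2 ≤ R' := (le_max_right _ _).trans (le_max_right _ _)
  have hGdec : ∀ z : ℂ, z.im < 0 → R' ≤ ‖z‖ → ‖G z‖ ≤ K' / ‖z‖ ^ 2 := by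
    intro z hz hzR
    have hz0 : 0 < ‖z‖ := by linarith
    have h1 : ‖z‖ / 2 ≤ ‖z - p‖ := by
      have := norm_sub_norm_le z (p : ℂ)
      rw [Complex.norm_real, Real.norm_of_nonneg hp.le] at this
      linarith
    have h2 : ‖z‖ / 2 ≤ ‖z - Complex.I‖ := by
      have := norm_sub_norm_le z Complex.I
      rw [Complex.norm_I] at this
      linarith
    have h3 : G z = (F z - c) / (z - p) + A * (Complex.I - p) / ((z - Complex.I) * (z - p)) := by
      have ha := hnep z hz
      have hb := hneI z hz.le
      simp only [hGdef, hA]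
      field_simp
      ring
    have h4 : ‖Complex.I - p‖ ≤ 1 + p := by
      refine (norm_sub_le _ _).trans ?_
      rw [Complex.norm_I, Complex.norm_real, Real.norm_of_nonneg hp.le]
    have h5 : ‖F z - c‖ ≤ |K| / ‖z‖ := (hdec z (hR'1.trans hzR)).trans (by gcongr; exact le_abs_self K)
    rw [h3]
    refine (norm_add_le _ _).trans ?_
    rw [norm_div, norm_div, norm_mul, norm_mul]
    have h6 : ‖F z - c‖ / ‖z - p‖ ≤ (|K| / ‖z‖) / (‖z‖ / 2) := by gcongr
    have h7 : ‖A‖ * ‖Complex.I - p‖ / (‖z - Complex.I‖ * ‖z - p‖) ≤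
        ‖A‖ * (1 + p) / ((‖z‖ / 2) * (‖z‖ / 2)) := by gcongr
    have h8 : (|K| / ‖z‖) / (‖z‖ / 2) = 2 * |K| / ‖z‖ ^ 2 := by field_simp
    have h9 : ‖A‖ * (1 + p) / ((‖z‖ / 2) * (‖z‖ / 2)) = 4 * (‖A‖ * (1 + p)) / ‖z‖ ^ 2 := by
      field_simp; ring
    have h10 : 2 * |K| / ‖z‖ ^ 2 ≤ 4 * |K| / ‖z‖ ^ 2 := by
      have := abs_nonneg K
      gcongr
      norm_num
    have h11 : K' / ‖z‖ ^ 2 = 4 * |K| / ‖z‖ ^ 2 + 4 * (‖A‖ * (1 + p)) / ‖z‖ ^ 2 := by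
      simp only [hK']; ring
    linarith
  obtain ⟨C, hC0, hC⟩ := hFp.isBigO_sub.exists_pos
  rw [IsBigOWith, Metric.eventually_nhds_iff] at hC
  obtain ⟨δ, hδ, hC⟩ := hC
  -- In the window, C bounds the difference quotient near p, and 2/δ bounds 1/|z − p| away from p;
  -- ‖A‖ bounds the second term. Outside the window the decay estimate takes over.
  set D : ℝ → ℝ := fun x => (Icc (-R') R').indicator
    (fun x => C + (|B x| + ‖F p‖) * (2 / δ) + ‖A‖) x + 2 * K' * (1 + x ^ 2)⁻¹ with hD
  have hDint : Integrable D := by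
    refine Integrable.add ?_ (integrable_inv_one_add_sq.const_mul _)
    rw [integrable_indicator_iff measurableSet_Icc]
    have h1 : IntegrableOn B (Icc (-R') R') := hB.integrableOn_isCompact isCompact_Icc
    have hc : ∀ c : ℝ, IntegrableOn (fun _ : ℝ => c) (Icc (-R') R') := fun c =>
      integrableOn_const (by simp)
    exact ((hc C).add ((h1.abs.add (hc _)).mul_const _)).add (hc _)
  have hK'0 : 0 ≤ K' := by have := abs_nonneg K; positivity
  have hGbound : ∀ᵐ x : ℝ, ∀ y : ℝ, -(δ / 2) < y → y < 0 → ‖G (x + y * Complex.I)‖ ≤ D x := by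
    filter_upwards [hbound] with x hx y hy1 hy2
    have him : (x + y * Complex.I : ℂ).im = y := by simp
    have hre : (x + y * Complex.I : ℂ).re = x := by simp
    by_cases hxR : x ∈ Icc (-R') R'
    · simp only [hD]
      rw [indicator_of_mem hxR]
      have h1 : 0 ≤ 2 * K' * (1 + x ^ 2)⁻¹ := by positivity
      have h2 : ‖A / (x + y * Complex.I - Complex.I)‖ ≤ ‖A‖ := by
        rw [norm_div]
        refine div_le_self (norm_nonneg _) ?_
        have := Complex.abs_im_le_norm (x + y * Complex.I - Complex.I)
        rw [Complex.sub_im, him, Complex.I_im, abs_of_neg (by linarith)] at this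
        linarith
      have h3 : ‖(F (x + y * Complex.I) - F p) / (x + y * Complex.I - p)‖ ≤
          C + (|B x| + ‖F p‖) * (2 / δ) := by
        have hpos : 0 < ‖(x + y * Complex.I - p : ℂ)‖ :=
          norm_pos_iff.2 (hnep _ (by rw [him]; exact hy2))
        have hn : 0 ≤ (|B x| + ‖F p‖) * (2 / δ) := by positivity
        rw [norm_div, div_le_iff₀ hpos]
        by_cases hxp : |x - p| < δ / 2
        · have hd : dist (x + y * Complex.I : ℂ) p < δ := by
            rw [dist_eq_norm]
            refine (Complex.norm_le_abs_re_add_abs_im _).trans_lt ?_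
            rw [Complex.sub_re, Complex.sub_im, him, hre, Complex.ofReal_re, Complex.ofReal_im,
              sub_zero, abs_of_neg hy2]
            linarith
          have := hC hd
          nlinarith
        · have hd : δ / 2 ≤ ‖(x + y * Complex.I - p : ℂ)‖ := by
            have := Complex.abs_re_le_norm (x + y * Complex.I - p)
            rw [Complex.sub_re, hre, Complex.ofReal_re] at this
            linarith
          have h4 : ‖F (x + y * Complex.I) - F p‖ ≤ |B x| + ‖F p‖ :=
            (norm_sub_le _ _).trans (add_le_add ((hx y hy2).trans (le_abs_self _)) le_rfl)
          have h5 : 1 ≤ 2 / δ * ‖(x + y * Complex.I - p : ℂ)‖ := by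
            rw [div_mul_eq_mul_div, le_div_iff₀ hδ]; linarith
          have h6 : 0 ≤ |B x| + ‖F p‖ := by positivity
          nlinarith [mul_le_mul_of_nonneg_left h5 h6]
      have := norm_add_le ((F (x + y * Complex.I) - F p) / (x + y * Complex.I - p))
        (A / (x + y * Complex.I - Complex.I))
      simp only [hGdef]
      linarith
    · simp only [hD]
      rw [indicator_of_notMem hxR, zero_add]
      have hxR' : R' ≤ |x| := by
        rw [mem_Icc, ← abs_le, not_le] at hxR
        exact hxR.le
      have hx2 : 1 ≤ x ^ 2 := by rw [← sq_abs]; nlinarith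
      refine (hGdec _ (by rw [him]; exact hy2) (hxR'.trans (abs_le_norm_add_mul_I x y))).trans ?_
      rw [sq_add_sq_eq_norm_sq, ← div_eq_mul_inv, div_le_div_iff₀ (by positivity) (by positivity)]
      nlinarith [mul_nonneg hK'0 (sq_nonneg y), mul_nonneg hK'0 (by linarith : 0 ≤ x ^ 2 - 1)]
  have hGlim : ∀ᵐ x : ℝ,
      Tendsto (fun y : ℝ => G (x + y * Complex.I)) (𝓝[<] 0) (𝓝 (G x)) := by
    have hne : ∀ᵐ x : ℝ, x ≠ p := by simp [ae_iff, measure_singleton]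
    filter_upwards [hlim, hne] with x hx hxp
    have hz : Tendsto (fun y : ℝ => (x + y * Complex.I : ℂ)) (𝓝[<] 0) (𝓝 (x : ℂ)) := by
      have : Continuous fun y : ℝ => (x + y * Complex.I : ℂ) := by fun_prop
      exact (by simpa using this.tendsto 0 : Tendsto _ (𝓝 (0 : ℝ)) _).mono_left nhdsWithin_le_nhds
    have h1 : (x : ℂ) - p ≠ 0 := by
      rw [sub_ne_zero]; exact_mod_cast hxp
    exact ((hx.sub_const _).div (hz.sub_const _) h1).add
      (tendsto_const_nhds.div (hz.sub_const _) (hneI x (by simp)))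
  obtain ⟨hGint, hG0⟩ := integral_boundary_eq_zero hG hGdec (half_pos hδ) hDint hGbound hGlim
  have hpim := hreal p hp
  have hAre : A = (((F p).re - c : ℝ) : ℂ) := by
    apply Complex.ext <;> simp [hA, hpim]
  -- F(p) and A are real, so only Im F and Im 1/(x − i) = 1/(1 + x²) survive. The latter integrates
  -- to π, which isolates F(p) − c.
  have him : ∀ x : ℝ, (G x).im = (F x).im / (x - p) + ((F p).re - c) * (1 + x ^ 2)⁻¹ := by
    intro x
    simp only [hGdef]
    rw [Complex.add_im, ← Complex.ofReal_sub, Complex.div_ofReal_im, Complex.sub_im, hpim, sub_zero,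
      hAre, ← mul_one_div ((((F p).re - c : ℝ)) : ℂ), Complex.im_ofReal_mul, ofReal_sub_I_inv_im]
  have hGim : ∫ x : ℝ, (G x).im = 0 := by
    have := integral_im (𝕜 := ℂ) hGint
    rw [hG0] at this
    simpa using this
  have hint2 : Integrable fun x : ℝ => ((F p).re - c) * (1 + x ^ 2)⁻¹ :=
    integrable_inv_one_add_sq.const_mul _
  have hint1 : Integrable fun x : ℝ => (F x).im / (x - p) := by
    have h := hGint.im.sub hint2
    refine h.congr (Eventually.of_forall fun x => ?_)
    have := him x
    simp only [Pi.sub_apply, RCLike.im_to_complex]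
    linarith
  simp only [him] at hGim
  rw [integral_add hint1 hint2, integral_const_mul, integral_univ_inv_one_add_sq] at hGim
  have hsupp : ∫ x : ℝ, (F x).im / (x - p) = ∫ x in Iic (0 : ℝ), (F x).im / (x - p) := by
    refine (setIntegral_eq_integral_of_forall_compl_eq_zero fun x hx => ?_).symm
    rw [hreal x (by simpa using hx), zero_div]
  have hneg := integral_comp_neg_Ioi (0 : ℝ) (fun x : ℝ => (F x).im / (x - p))
  rw [neg_zero, ← hsupp] at hneg
  have hfin : ∫ r in Ioi (0 : ℝ), (F (-(r : ℂ))).im / (p + r) =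
      -∫ r in Ioi (0 : ℝ), (F ((-r : ℝ) : ℂ)).im / (-r - p) := by
    rw [← integral_neg]
    refine setIntegral_congr_fun measurableSet_Ioi fun r hr => ?_
    simp only [Complex.ofReal_neg]
    rw [← div_neg]
    congr 1
    ring
  rw [hfin, hneg]
  have := Real.pi_pos
  field_simp
  linarith

/-! ### The square root of p J~(p) and its boundary values -/

theorem locallyIntegrable_abs_add_rpow_neg (b : ℝ) {a : ℝ} (ha : a < 1) :
    LocallyIntegrable fun x : ℝ => |x + b| ^ (-a) := by
  have h : LocallyIntegrable fun x : ℝ => |x| ^ (-a) := by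
    refine locallyIntegrable_of_norm_le_rpow (α := a) (C := 1) (by simp) (by simpa using ha)
      (Eventually.of_forall fun x => ?_)
      (measurable_abs.pow_const _).aestronglyMeasurable
    rw [Real.norm_of_nonneg (by positivity), one_mul, Real.norm_eq_abs]
  have h2 := (locallyIntegrable_map_homeomorph (Homeomorph.addRight b)
    (f := fun x : ℝ => |x| ^ (-a)) (μ := volume)).1 (by
      rw [show Measure.map (Homeomorph.addRight b) (volume : Measure ℝ) = volume from
        (measurePreserving_add_right volume b).map_eq]
      exact h)
  simpa [Function.comp_def] using h2

/-- The principal square root of the Strick-Mainardi function `p J~(p)`. -/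
noncomputable def sqrtCarson (J₀ M₀ Ω α : ℝ) (z : ℂ) : ℂ :=
  strickMainardiCarson J₀ M₀ Ω α z ^ (1 / 2 : ℂ)

theorem one_add_div_im (Ω : ℝ) (z : ℂ) :
    (1 + (Ω : ℂ) / z).im = Ω * (-z.im / Complex.normSq z) := by
  rw [div_eq_mul_inv, Complex.add_im, Complex.im_ofReal_mul, Complex.inv_im, Complex.one_im,
    zero_add]

theorem one_add_div_im_pos {Ω : ℝ} (hΩ : 0 < Ω) {z : ℂ} (hz : z.im < 0) :
    0 < (1 + (Ω : ℂ) / z).im := by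
  rw [one_add_div_im]
  have : 0 < Complex.normSq z := Complex.normSq_pos.2 fun h => by simp [h] at hz
  have := neg_pos.2 hz
  positivity

theorem one_add_div_ofReal (Ω x : ℝ) : (1 + (Ω : ℂ) / (x : ℂ)) = ((1 + Ω / x : ℝ) : ℂ) := by
  push_cast; rfl

theorem one_add_div_eq {Ω : ℝ} {z : ℂ} (hz : z ≠ 0) : 1 + (Ω : ℂ) / z = (z + Ω) / z := by
  field_simp

theorem measurable_carsonOf (J₀ M₀ α : ℝ) : Measurable (carsonOf J₀ M₀ α) := by
  unfold carsonOf
  split_ifs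
  · exact (Complex.measurable_log.const_mul _).const_add _
  · exact (((measurable_id.pow_const _).sub_const _).const_mul _).const_add _

theorem measurable_sqrtCarson (J₀ M₀ Ω α : ℝ) : Measurable (sqrtCarson J₀ M₀ Ω α) :=
  ((measurable_carsonOf J₀ M₀ α).comp ((measurable_const.div measurable_id).const_add 1)).pow_const _

section

variable {J₀ M₀ Ω α : ℝ}

theorem differentiableOn_sqrtCarson (hM₀ : 0 < M₀) (hΩ : 0 < Ω) (hα₁ : -1 < α) (hα₂ : α < 1) :
    DifferentiableOn ℂ (sqrtCarson J₀ M₀ Ω α) {z | z.im < 0} := by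
  intro z hz
  have hw := one_add_div_im_pos hΩ hz
  have hz0 : z ≠ 0 := fun h => by simp [h] at hz
  have h1 : DifferentiableAt ℂ (fun z : ℂ => 1 + (Ω : ℂ) / z) z :=
    ((differentiableAt_const _).div differentiableAt_id hz0).const_add _
  have h2 : DifferentiableAt ℂ (fun z : ℂ => carsonOf J₀ M₀ α (1 + (Ω : ℂ) / z)) z :=
    DifferentiableAt.comp z
      (differentiableAt_carsonOf (Complex.mem_slitPlane_iff.2 (Or.inr hw.ne'))) h1
  exact (h2.cpow_const (Complex.mem_slitPlane_iff.2 (Or.inr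
    (carsonOf_im_pos hM₀ hα₁ hα₂ hw).ne'))).differentiableWithinAt

theorem carson_ofReal_eq (hΩ : 0 < Ω) (hα₁ : -1 < α) (hα₂ : α < 1) {p : ℝ} (hp : 0 < p) :
    strickMainardiCarson J₀ M₀ Ω α p =
      ((p * laplaceTransform (strickMainardiCreep J₀ M₀ Ω α) p : ℝ) : ℂ) := by
  rw [strickMainardiCarson_eq, one_add_div_ofReal, carsonOf_ofReal _ (by positivity)]
  split_ifs with h
  · rw [h, mul_laplaceTransform_creep_of_eq_zero J₀ M₀ hΩ hp]
  · rw [mul_laplaceTransform_creep_of_ne_zero J₀ M₀ hΩ hα₁ hα₂ h hp]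

theorem mul_laplaceTransform_creep_pos (hJ₀ : 0 < J₀) (hM₀ : 0 < M₀) (hΩ : 0 < Ω) (hα₁ : -1 < α)
    (hα₂ : α < 1) {p : ℝ} (hp : 0 < p) :
    0 < p * laplaceTransform (strickMainardiCreep J₀ M₀ Ω α) p := by
  have hw : 1 < 1 + Ω / p := by have := div_pos hΩ hp; linarith
  rcases eq_or_ne α 0 with rfl | h
  · rw [mul_laplaceTransform_creep_of_eq_zero J₀ M₀ hΩ hp]
    have := Real.log_pos hw
    positivity
  · rw [mul_laplaceTransform_creep_of_ne_zero J₀ M₀ hΩ hα₁ hα₂ h hp, div_mul_eq_mul_div,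
      mul_div_assoc]
    have : 0 ≤ ((1 + Ω / p) ^ α - 1) / α := by
      rcases lt_or_gt_of_ne h with h | h
      · exact div_nonneg_of_nonpos
          (sub_nonpos.2 (Real.rpow_le_one_of_one_le_of_nonpos hw.le h.le)) h.le
      · exact div_nonneg (sub_nonneg.2 (Real.one_le_rpow hw.le h.le)) h.le
    positivity

theorem ofReal_cpow_half {x : ℝ} (hx : 0 ≤ x) : (x : ℂ) ^ (1 / 2 : ℂ) = (√x : ℝ) := by
  rw [Real.sqrt_eq_rpow, Complex.ofReal_cpow hx]
  push_cast
  rfl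

theorem sqrtCarson_ofReal (hJ₀ : 0 < J₀) (hM₀ : 0 < M₀) (hΩ : 0 < Ω) (hα₁ : -1 < α)
    (hα₂ : α < 1) {p : ℝ} (hp : 0 < p) :
    sqrtCarson J₀ M₀ Ω α p =
      (√(p * laplaceTransform (strickMainardiCreep J₀ M₀ Ω α) p) : ℝ) := by
  rw [sqrtCarson, carson_ofReal_eq hΩ hα₁ hα₂ hp,
    ofReal_cpow_half (mul_laplaceTransform_creep_pos hJ₀ hM₀ hΩ hα₁ hα₂ hp).le]

theorem differentiableAt_sqrtCarson_ofReal (hJ₀ : 0 < J₀) (hM₀ : 0 < M₀) (hΩ : 0 < Ω)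
    (hα₁ : -1 < α) (hα₂ : α < 1) {p : ℝ} (hp : 0 < p) :
    DifferentiableAt ℂ (sqrtCarson J₀ M₀ Ω α) p := by
  have hz0 : (p : ℂ) ≠ 0 := by exact_mod_cast hp.ne'
  have h1 : DifferentiableAt ℂ (fun z : ℂ => 1 + (Ω : ℂ) / z) (p : ℂ) :=
    ((differentiableAt_const (Ω : ℂ)).div differentiableAt_id hz0).const_add _
  have h2 : DifferentiableAt ℂ (fun z : ℂ => carsonOf J₀ M₀ α (1 + (Ω : ℂ) / z)) p := by
    refine DifferentiableAt.comp (p : ℂ) (differentiableAt_carsonOf ?_) h1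
    rw [one_add_div_ofReal, Complex.ofReal_mem_slitPlane]
    positivity
  refine h2.cpow_const ?_
  rw [← strickMainardiCarson_eq, carson_ofReal_eq hΩ hα₁ hα₂ hp, Complex.ofReal_mem_slitPlane]
  exact mul_laplaceTransform_creep_pos hJ₀ hM₀ hΩ hα₁ hα₂ hp

/-- As a function of ζ = 1/z the root is differentiable at ζ = 0, where w = 1 and the radicand is J₀
> 0. -/
theorem exists_norm_sqrtCarson_sub_le (hJ₀ : 0 < J₀) :
    ∃ K R : ℝ, 0 < R ∧
      ∀ z : ℂ, R ≤ ‖z‖ → ‖sqrtCarson J₀ M₀ Ω α z - (√J₀ : ℝ)‖ ≤ K / ‖z‖ := by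
  set E : ℂ → ℂ := fun ζ => carsonOf J₀ M₀ α (1 + Ω * ζ) ^ (1 / 2 : ℂ) with hE
  have hE0 : E 0 = (√J₀ : ℝ) := by
    simp only [hE]
    rw [mul_zero, add_zero, carsonOf_one, ofReal_cpow_half hJ₀.le]
  have hd : DifferentiableAt ℂ E 0 := by
    have h1 : DifferentiableAt ℂ (fun ζ : ℂ => carsonOf J₀ M₀ α (1 + Ω * ζ)) 0 :=
      DifferentiableAt.comp (0 : ℂ) (differentiableAt_carsonOf (by simp))
        ((differentiableAt_id.const_mul _).const_add _)
    refine h1.cpow_const ?_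
    rw [mul_zero, add_zero, carsonOf_one, Complex.ofReal_mem_slitPlane]
    exact hJ₀
  obtain ⟨C, -, hC⟩ := hd.isBigO_sub.exists_pos
  rw [IsBigOWith, Metric.eventually_nhds_iff] at hC
  obtain ⟨δ, hδ, hC⟩ := hC
  refine ⟨C, 2 / δ, by positivity, fun z hz => ?_⟩
  have hz0 : 0 < ‖z‖ := lt_of_lt_of_le (by positivity) hz
  have h := hC (y := z⁻¹) (by
    rw [dist_zero_right, norm_inv]
    calc ‖z‖⁻¹ ≤ (2 / δ)⁻¹ := inv_anti₀ (by positivity) hz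
      _ < δ := by rw [inv_div]; linarith)
  rw [hE0, sub_zero, norm_inv, ← div_eq_mul_inv] at h
  exact h

/-- From below the real axis, both w and p J~(p) approach their limits within the closed upper
half-plane, where principal powers and logarithms are continuous up to the cut. The two excluded
points are w = ∞ and w = 0. -/
theorem tendsto_sqrtCarson_boundary (hM₀ : 0 < M₀) (hΩ : 0 < Ω) (hα₁ : -1 < α) (hα₂ : α < 1)
    {x : ℝ} (hx : x ≠ 0) (hxΩ : x + Ω ≠ 0) :
    Tendsto (fun y : ℝ => sqrtCarson J₀ M₀ Ω α (x + y * Complex.I)) (𝓝[<] 0)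
      (𝓝 (sqrtCarson J₀ M₀ Ω α x)) := by
  have hx0 : (x : ℂ) ≠ 0 := by exact_mod_cast hx
  have hw0 : 1 + (Ω : ℂ) / x ≠ 0 := by
    rw [one_add_div_eq hx0]
    exact div_ne_zero (by exact_mod_cast hxΩ) hx0
  have hz : Tendsto (fun y : ℝ => (x + y * Complex.I : ℂ)) (𝓝[<] 0) (𝓝 (x : ℂ)) := by
    have : Continuous fun y : ℝ => (x + y * Complex.I : ℂ) := by fun_prop
    exact (by simpa using this.tendsto 0 : Tendsto _ (𝓝 (0 : ℝ)) _).mono_left nhdsWithin_le_nhds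
  have hw : Tendsto (fun y : ℝ => 1 + (Ω : ℂ) / (x + y * Complex.I)) (𝓝[<] 0)
      (𝓝[{z : ℂ | 0 ≤ z.im}] (1 + (Ω : ℂ) / x)) := by
    refine tendsto_nhdsWithin_iff.2 ⟨(tendsto_const_nhds.div hz hx0).const_add _, ?_⟩
    filter_upwards [self_mem_nhdsWithin] with y hy
    exact (one_add_div_im_pos hΩ (by simpa using hy)).le
  have hQ : Tendsto (fun y : ℝ => carsonOf J₀ M₀ α (1 + (Ω : ℂ) / (x + y * Complex.I))) (𝓝[<] 0)
      (𝓝[{z : ℂ | 0 ≤ z.im}] (carsonOf J₀ M₀ α (1 + (Ω : ℂ) / x))) := by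
    refine tendsto_nhdsWithin_iff.2
      ⟨(continuousWithinAt_carsonOf hw0).tendsto.comp hw, ?_⟩
    filter_upwards [tendsto_nhdsWithin_iff.1 hw |>.2] with y hy
    exact carsonOf_im_nonneg hM₀ hα₁ hα₂ hy
  exact (continuousWithinAt_cpow_half_upper _).tendsto.comp hQ

/-- Uniformly in y, ‖w‖ ≤ 1 + Ω/|x| and ‖w‖⁻¹ ≤ 1 + Ω/|x + Ω|. Raised to a power a < 1 both are
locally integrable, and the crude √u ≤ 1 + u handles the root. -/
theorem exists_norm_sqrtCarson_le (J₀ M₀ : ℝ) (hΩ : 0 < Ω) (hα₁ : -1 < α) (hα₂ : α < 1) :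
    ∃ B : ℝ → ℝ, LocallyIntegrable B ∧ ∀ᵐ x : ℝ, ∀ y : ℝ,
      ‖sqrtCarson J₀ M₀ Ω α (x + y * Complex.I)‖ ≤ B x := by
  obtain ⟨a, C, ha₀, ha₁, hC, hbound⟩ := exists_norm_carsonOf_le J₀ M₀ hα₁ hα₂
  refine ⟨fun x => 1 + C * (3 + Ω ^ a * |x + 0| ^ (-a) + Ω ^ a * |x + Ω| ^ (-a)), ?_, ?_⟩
  · have h1 := locallyIntegrable_abs_add_rpow_neg 0 ha₁
    have h2 := locallyIntegrable_abs_add_rpow_neg Ω ha₁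
    have hc : ∀ c : ℝ, LocallyIntegrable fun _ : ℝ => c := fun c => locallyIntegrable_const c
    have h3 := ((hc 3).add (h1.smul (Ω ^ a))).add (h2.smul (Ω ^ a))
    exact (hc 1).add (h3.smul C)
  · have hne : ∀ᵐ x : ℝ, x ≠ 0 := by simp [ae_iff, measure_singleton]
    have hne' : ∀ᵐ x : ℝ, x ≠ -Ω := by simp [ae_iff, measure_singleton]
    filter_upwards [hne, hne'] with x hx hxΩ y
    have hxΩ' : x + Ω ≠ 0 := fun h => hxΩ (by linarith)
    set z : ℂ := x + y * Complex.I with hz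
    have hz1 : |x| ≤ ‖z‖ := abs_le_norm_add_mul_I x y
    have hz2 : |x + Ω| ≤ ‖z + Ω‖ := by
      have := abs_le_norm_add_mul_I (x + Ω) y
      rwa [show ((x + Ω : ℝ) + y * Complex.I : ℂ) = z + Ω by simp only [hz]; push_cast; ring]
        at this
    have hx1 := abs_pos.2 hx
    have hx2 := abs_pos.2 hxΩ'
    have hz0 : z ≠ 0 := norm_pos_iff.1 (hx1.trans_le hz1)
    have hzΩ0 : z + Ω ≠ 0 := norm_pos_iff.1 (hx2.trans_le hz2)
    have hw0 : 1 + (Ω : ℂ) / z ≠ 0 := by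
      rw [one_add_div_eq hz0]
      exact div_ne_zero hzΩ0 hz0
    have hnΩ : ‖(Ω : ℂ)‖ = Ω := by rw [Complex.norm_real, Real.norm_of_nonneg hΩ.le]
    have h1 : ‖1 + (Ω : ℂ) / z‖ ^ a ≤ 1 + Ω ^ a * |x| ^ (-a) := by
      have h : ‖1 + (Ω : ℂ) / z‖ ≤ 1 + Ω / |x| := by
        refine (norm_add_le _ _).trans ?_
        rw [norm_one, norm_div, hnΩ]
        gcongr
      refine (Real.rpow_le_rpow (norm_nonneg _) h ha₀.le).trans
        ((one_add_rpow_le (by positivity) ha₀ ha₁).trans_eq ?_)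
      rw [Real.div_rpow hΩ.le hx1.le, Real.rpow_neg hx1.le, div_eq_mul_inv]
    have h2 : ‖1 + (Ω : ℂ) / z‖ ^ (-a) ≤ 1 + Ω ^ a * |x + Ω| ^ (-a) := by
      have h : ‖1 + (Ω : ℂ) / z‖⁻¹ ≤ 1 + Ω / |x + Ω| := by
        rw [one_add_div_eq hz0, ← norm_inv, inv_div,
          show z / (z + Ω) = 1 - Ω / (z + Ω) by field_simp; ring]
        refine (norm_sub_le _ _).trans ?_
        rw [norm_one, norm_div, hnΩ]
        gcongr
      rw [Real.rpow_neg (norm_nonneg _), ← Real.inv_rpow (norm_nonneg _)]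
      refine (Real.rpow_le_rpow (by positivity) h ha₀.le).trans
        ((one_add_rpow_le (by positivity) ha₀ ha₁).trans_eq ?_)
      rw [Real.div_rpow hΩ.le hx2.le, Real.rpow_neg hx2.le, div_eq_mul_inv]
    have h3 : ‖sqrtCarson J₀ M₀ Ω α z‖ ≤ 1 + ‖carsonOf J₀ M₀ α (1 + Ω / z)‖ := by
      rw [sqrtCarson, norm_cpow_half, strickMainardiCarson_eq, Real.sqrt_le_left (by positivity)]
      nlinarith [norm_nonneg (carsonOf J₀ M₀ α (1 + Ω / z))]
    refine h3.trans (add_le_add_right ((hbound _ hw0).trans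
      (mul_le_mul_of_nonneg_left ?_ hC.le)) _)
    rw [add_zero]
    linarith

theorem ae_tendsto_sqrtCarson_boundary (J₀ : ℝ) (hM₀ : 0 < M₀) (hΩ : 0 < Ω) (hα₁ : -1 < α)
    (hα₂ : α < 1) : ∀ᵐ x : ℝ, Tendsto (fun y : ℝ => sqrtCarson J₀ M₀ Ω α (x + y * Complex.I))
      (𝓝[<] 0) (𝓝 (sqrtCarson J₀ M₀ Ω α x)) := by
  have hne : ∀ᵐ x : ℝ, x ≠ 0 := by simp [ae_iff, measure_singleton]
  have hne' : ∀ᵐ x : ℝ, x ≠ -Ω := by simp [ae_iff, measure_singleton]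
  filter_upwards [hne, hne'] with x hx hxΩ
  exact tendsto_sqrtCarson_boundary hM₀ hΩ hα₁ hα₂ hx fun h => hxΩ (by linarith)

/-- For large r, w = 1 − Ω/r is close to 1 and the radicand is a positive real close to J₀. The
support of h may extend beyond Ω, because the radicand can be negative for r just above Ω. -/
theorem eventually_sqrtCarson_neg_im_eq_zero (hJ₀ : 0 < J₀) :
    ∀ᶠ r : ℝ in atTop, (sqrtCarson J₀ M₀ Ω α (-(r : ℂ))).im = 0 := by
  have hc : ContinuousAt (fun w : ℂ => (carsonOf J₀ M₀ α w).re) 1 :=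
    Complex.continuous_re.continuousAt.comp
      (differentiableAt_carsonOf (by simp)).continuousAt
  have h1 : ∀ᶠ w : ℂ in 𝓝 1, 0 < (carsonOf J₀ M₀ α w).re := by
    refine hc.eventually_const_lt ?_
    simpa [carsonOf_one] using hJ₀
  have hw : Tendsto (fun r : ℝ => 1 + Ω / (-r)) atTop (𝓝 1) := by
    have : Tendsto (fun r : ℝ => Ω / (-r)) atTop (𝓝 0) :=
      tendsto_const_nhds.div_atBot tendsto_neg_atTop_atBot
    simpa using this.const_add 1
  have hw' : Tendsto (fun r : ℝ => ((1 + Ω / (-r) : ℝ) : ℂ)) atTop (𝓝 1) := by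
    have := (Complex.continuous_ofReal.tendsto 1).comp hw
    simpa only [Function.comp_def, Complex.ofReal_one] using this
  filter_upwards [hw'.eventually h1, hw.eventually_const_lt (zero_lt_one)] with r hr hr0
  rw [sqrtCarson, strickMainardiCarson_eq, ← Complex.ofReal_neg, one_add_div_ofReal]
  rw [carsonOf_ofReal _ hr0.le, Complex.ofReal_re] at hr
  rw [carsonOf_ofReal _ hr0.le, ofReal_cpow_half hr.le, Complex.ofReal_im]

/-- The local bound passes to the boundary limit, and vanishing for large r upgrades local
integrability. -/
theorem integrableOn_sqrtCarson_neg_im (hJ₀ : 0 < J₀) (hM₀ : 0 < M₀) (hΩ : 0 < Ω) (hα₁ : -1 < α)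
    (hα₂ : α < 1) :
    IntegrableOn (fun r : ℝ => (sqrtCarson J₀ M₀ Ω α (-(r : ℂ))).im) (Ioi 0) := by
  obtain ⟨B, hB, hbound⟩ := exists_norm_sqrtCarson_le J₀ M₀ hΩ hα₁ hα₂
  have hlim := ae_tendsto_sqrtCarson_boundary J₀ hM₀ hΩ hα₁ hα₂
  obtain ⟨R, hR⟩ := eventually_atTop.1
    (eventually_sqrtCarson_neg_im_eq_zero (M₀ := M₀) (Ω := Ω) (α := α) hJ₀)
  have hle : ∀ᵐ x : ℝ, ‖(sqrtCarson J₀ M₀ Ω α x).im‖ ≤ B x := by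
    filter_upwards [hbound, hlim] with x h1 h2
    exact (Complex.abs_im_le_norm _).trans
      (le_of_tendsto h2.norm (Eventually.of_forall fun y => h1 y))
  have hmeas : Measurable fun x : ℝ => (sqrtCarson J₀ M₀ Ω α x).im :=
    Complex.measurable_im.comp ((measurable_sqrtCarson J₀ M₀ Ω α).comp Complex.measurable_ofReal)
  have h1 : LocallyIntegrable fun x : ℝ => (sqrtCarson J₀ M₀ Ω α x).im :=
    hB.mono hmeas.aestronglyMeasurable
      (hle.mono fun x hx => hx.trans (le_abs_self _))
  have h2 := (locallyIntegrable_map_homeomorph (Homeomorph.neg ℝ)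
    (f := fun x : ℝ => (sqrtCarson J₀ M₀ Ω α x).im) (μ := volume)).1 (by
      rw [show Measure.map (Homeomorph.neg ℝ) (volume : Measure ℝ) = volume from
        (Measure.measurePreserving_neg (volume : Measure ℝ)).map_eq]
      exact h1)
  have h3 : LocallyIntegrable fun r : ℝ => (sqrtCarson J₀ M₀ Ω α (-(r : ℂ))).im := by
    simpa [Function.comp_def] using h2
  have h4 : IntegrableOn (fun r : ℝ => (sqrtCarson J₀ M₀ Ω α (-(r : ℂ))).im)
      (Icc 0 R ∪ Ioi R) := by
    refine (h3.integrableOn_isCompact isCompact_Icc).union ?_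
    exact integrableOn_zero.congr_fun (fun r hr => (hR r (le_of_lt hr)).symm) measurableSet_Ioi
  refine h4.mono_set fun r hr => ?_
  rcases le_or_gt r R with h | h
  · exact Or.inl ⟨le_of_lt hr, h⟩
  · exact Or.inr h

theorem sqrt_mul_laplaceTransform_eq (hJ₀ : 0 < J₀) (hM₀ : 0 < M₀) (hΩ : 0 < Ω) (hα₁ : -1 < α)
    (hα₂ : α < 1) {p : ℝ} (hp : 0 < p) :
    √(p * laplaceTransform (strickMainardiCreep J₀ M₀ Ω α) p) =
      √J₀ + 1 / Real.pi *
        ∫ r in Ioi (0 : ℝ), (sqrtCarson J₀ M₀ Ω α (-(r : ℂ))).im / (p + r) := by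
  obtain ⟨B, hB, hbound⟩ := exists_norm_sqrtCarson_le J₀ M₀ hΩ hα₁ hα₂
  obtain ⟨K, R, -, hdec⟩ := exists_norm_sqrtCarson_sub_le (M₀ := M₀) (Ω := Ω) (α := α) hJ₀
  have h := stieltjes_representation hp
    (differentiableOn_sqrtCarson hM₀ hΩ hα₁ hα₂)
    (differentiableAt_sqrtCarson_ofReal hJ₀ hM₀ hΩ hα₁ hα₂ hp)
    (fun x hx => by rw [sqrtCarson_ofReal hJ₀ hM₀ hΩ hα₁ hα₂ hx, Complex.ofReal_im])
    hdec hB (hbound.mono fun x hx y _ => hx y)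
    (ae_tendsto_sqrtCarson_boundary J₀ hM₀ hΩ hα₁ hα₂)
  rwa [sqrtCarson_ofReal hJ₀ hM₀ hΩ hα₁ hα₂ hp, Complex.ofReal_re] at h

end

/-! ### Uniqueness of the measure with a given Stieltjes transform -/

section Moments

variable {μ ν : Measure ℝ}

theorem integrable_of_ae_mem_Icc [IsFiniteMeasure μ] (hμ : ∀ᵐ s ∂μ, s ∈ Icc (0 : ℝ) 1)
    {f : ℝ → ℝ} (hf : Measurable f) (h : ∀ s ∈ Icc (0 : ℝ) 1, |f s| ≤ 1) : Integrable f μ :=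
  (integrable_const (1 : ℝ)).mono' hf.aestronglyMeasurable (hμ.mono fun s hs => h s hs)

theorem abs_pow_div_one_add_mul_le {q s : ℝ} (hq : 0 ≤ q) (hs : s ∈ Icc (0 : ℝ) 1) (n : ℕ) :
    |s ^ n / (1 + q * s)| ≤ 1 := by
  have h1 := pow_le_one₀ hs.1 hs.2 (n := n)
  have h2 : 0 ≤ q * s := mul_nonneg hq hs.1
  have h3 := pow_nonneg hs.1 n
  rw [abs_of_nonneg (by positivity), div_le_one (by positivity)]
  linarith

theorem tendsto_integral_pow_div [IsFiniteMeasure μ] (hμ : ∀ᵐ s ∂μ, s ∈ Icc (0 : ℝ) 1) (n : ℕ) :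
    Tendsto (fun q : ℝ => ∫ s, s ^ n / (1 + q * s) ∂μ) (𝓝[>] 0) (𝓝 (∫ s, s ^ n ∂μ)) := by
  refine tendsto_integral_filter_of_dominated_convergence (fun _ => 1) ?_ ?_
    (integrable_const _) ?_
  · exact Eventually.of_forall fun q => by
      apply Measurable.aestronglyMeasurable
      fun_prop
  · filter_upwards [self_mem_nhdsWithin] with q hq
    exact hμ.mono fun s hs => abs_pow_div_one_add_mul_le (le_of_lt hq) hs n
  · refine Eventually.of_forall fun s => ?_
    have : ContinuousAt (fun q : ℝ => s ^ n / (1 + q * s)) 0 :=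
      ContinuousAt.div (by fun_prop) (by fun_prop) (by simp)
    have h := this.tendsto
    simp only [zero_mul, add_zero, div_one] at h
    exact h.mono_left nhdsWithin_le_nhds

/-- Induction through s^(n+1)/(1 + qs) = (s^n − s^n/(1 + qs))/q. The n-th moments agree by letting q
→ 0+ in the case n. -/
theorem integral_pow_div_eq [IsFiniteMeasure μ] [IsFiniteMeasure ν]
    (hμ : ∀ᵐ s ∂μ, s ∈ Icc (0 : ℝ) 1) (hν : ∀ᵐ s ∂ν, s ∈ Icc (0 : ℝ) 1)
    (h : ∀ q : ℝ, 0 < q → ∫ s, 1 / (1 + q * s) ∂μ = ∫ s, 1 / (1 + q * s) ∂ν) (n : ℕ) :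
    ∀ q : ℝ, 0 < q → ∫ s, s ^ n / (1 + q * s) ∂μ = ∫ s, s ^ n / (1 + q * s) ∂ν := by
  induction n with
  | zero => simpa using h
  | succ n ih =>
    have hmom : ∫ s, s ^ n ∂μ = ∫ s, s ^ n ∂ν := by
      refine tendsto_nhds_unique (tendsto_integral_pow_div hμ n)
        ((tendsto_integral_pow_div hν n).congr' ?_)
      filter_upwards [self_mem_nhdsWithin] with q hq
      exact (ih q hq).symm
    intro q hq
    have key : ∀ m : Measure ℝ, IsFiniteMeasure m → (∀ᵐ s ∂m, s ∈ Icc (0 : ℝ) 1) →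
        ∫ s, s ^ (n + 1) / (1 + q * s) ∂m =
          (∫ s, s ^ n ∂m - ∫ s, s ^ n / (1 + q * s) ∂m) / q := by
      intro m _ hm
      rw [← integral_sub, ← integral_div]
      · refine integral_congr_ae (hm.mono fun s hs => ?_)
        have h2 : 0 ≤ q * s := mul_nonneg hq.le hs.1
        have h3 : 1 + q * s ≠ 0 := by positivity
        simp only
        field_simp
        ring
      · exact integrable_of_ae_mem_Icc hm (by fun_prop) fun s hs => by
          rw [abs_of_nonneg (pow_nonneg hs.1 n)]; exact pow_le_one₀ hs.1 hs.2
      · exact integrable_of_ae_mem_Icc hm (by fun_prop) fun s hs =>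
          abs_pow_div_one_add_mul_le hq.le hs n
    rw [key μ inferInstance hμ, key ν inferInstance hν, hmom, ih q hq]

/-- The exponential series may be integrated termwise, because on [0, 1] all moments are at most the
total mass. -/
theorem charFun_eq_tsum_moments [IsFiniteMeasure μ] (hμ : ∀ᵐ s ∂μ, s ∈ Icc (0 : ℝ) 1) (t : ℝ) :
    charFun μ t = ∑' n : ℕ, (t * Complex.I) ^ n / (n.factorial : ℂ) * ((∫ s, s ^ n ∂μ : ℝ) : ℂ) := by
  set F : ℕ → ℝ → ℂ := fun n s => (t * Complex.I) ^ n / (n.factorial : ℂ) * ((s ^ n : ℝ) : ℂ) with hF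
  have hint : ∀ n, Integrable (fun s : ℝ => s ^ n) μ := fun n =>
    integrable_of_ae_mem_Icc hμ (by fun_prop) fun s hs => by
      rw [abs_of_nonneg (pow_nonneg hs.1 n)]; exact pow_le_one₀ hs.1 hs.2
  have hFint : ∀ n, Integrable (F n) μ := fun n => (hint n).ofReal.const_mul _
  have hnorm : ∀ n, ∫ s, ‖F n s‖ ∂μ ≤ |t| ^ n / (n.factorial : ℝ) * μ.real univ := by
    intro n
    have h1 : ∫ s, ‖F n s‖ ∂μ ≤ ∫ _, |t| ^ n / (n.factorial : ℝ) ∂μ := by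
      refine integral_mono_ae (hFint n).norm (integrable_const _) (hμ.mono fun s hs => ?_)
      simp only [hF]
      rw [norm_mul, norm_div, norm_pow, norm_mul, Complex.norm_I, Complex.norm_real,
        Complex.norm_real, Complex.norm_natCast, mul_one, Real.norm_eq_abs,
        Real.norm_of_nonneg (pow_nonneg hs.1 n)]
      exact mul_le_of_le_one_right (by positivity) (pow_le_one₀ hs.1 hs.2)
    refine h1.trans_eq ?_
    rw [integral_const, smul_eq_mul, mul_comm]
  have hsum : Summable fun n => ∫ s, ‖F n s‖ ∂μ :=
    Summable.of_nonneg_of_le (fun n => integral_nonneg fun s => norm_nonneg _) hnorm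
      ((Real.summable_pow_div_factorial |t|).mul_right _)
  have h := hasSum_integral_of_summable_integral_norm hFint hsum
  have hpt : ∀ s : ℝ, ∑' n, F n s = Complex.exp (t * s * Complex.I) := by
    intro s
    rw [Complex.exp_eq_exp_ℂ, NormedSpace.exp_eq_tsum_div]
    congr 1
    ext n
    simp only [hF]
    push_cast
    rw [show (t : ℂ) * s * Complex.I = (t * Complex.I) * s by ring, mul_pow]
    ring
  simp only [hpt] at h
  rw [charFun_apply_real, ← h.tsum_eq]
  congr 1
  ext n
  simp only [hF]
  rw [integral_const_mul]
  exact congrArg _ integral_ofReal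

theorem eq_of_integral_one_div_eq [IsFiniteMeasure μ] [IsFiniteMeasure ν]
    (hμ : ∀ᵐ s ∂μ, s ∈ Icc (0 : ℝ) 1) (hν : ∀ᵐ s ∂ν, s ∈ Icc (0 : ℝ) 1)
    (h : ∀ q : ℝ, 0 < q → ∫ s, 1 / (1 + q * s) ∂μ = ∫ s, 1 / (1 + q * s) ∂ν) : μ = ν := by
  refine Measure.ext_of_charFun (funext fun t => ?_)
  rw [charFun_eq_tsum_moments hμ, charFun_eq_tsum_moments hν]
  congr 1
  ext n
  have hmom : ∫ s, s ^ n ∂μ = ∫ s, s ^ n ∂ν := by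
    refine tendsto_nhds_unique (tendsto_integral_pow_div hμ n)
      ((tendsto_integral_pow_div hν n).congr' ?_)
    filter_upwards [self_mem_nhdsWithin] with q hq
    exact (integral_pow_div_eq hμ hν h n q hq).symm
  rw [hmom]

end Moments

theorem lintegral_one_div_eq (μ : Measure ℝ) :
    ((μ.restrict (Ioi 0)).withDensity fun r => ENNReal.ofReal (1 / (1 + r))) univ =
      ∫⁻ r in Ioi (0 : ℝ), ENNReal.ofReal (1 / (1 + r)) ∂μ := by
  rw [withDensity_apply _ MeasurableSet.univ, Measure.restrict_univ]

theorem ae_map_one_div_mem_Icc (μ : Measure ℝ) :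
    ∀ᵐ s ∂(((μ.restrict (Ioi 0)).withDensity fun r => ENNReal.ofReal (1 / (1 + r))).map
      fun r => 1 / (1 + r)), s ∈ Icc (0 : ℝ) 1 := by
  refine (ae_map_iff (p := fun s => s ∈ Icc (0 : ℝ) 1) (by fun_prop) measurableSet_Icc).2 ?_
  refine (withDensity_absolutelyContinuous _ _).ae_le ?_
  refine (ae_restrict_iff' measurableSet_Ioi).2 (Eventually.of_forall fun r hr => ?_)
  have hr : 0 < r := hr
  refine ⟨by positivity, ?_⟩
  rw [div_le_one (by positivity)]
  linarith

/-- With s = 1/(1 + r), the weight s/(1 + qs) is 1/(1 + q + r). Only values p = 1 + q > 1 of the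
Stieltjes transform enter. -/
theorem integral_map_one_div (μ : Measure ℝ) {q : ℝ} (hq : 0 < q) :
    ∫ s, 1 / (1 + q * s) ∂(((μ.restrict (Ioi 0)).withDensity
      fun r => ENNReal.ofReal (1 / (1 + r))).map fun r => 1 / (1 + r)) =
      ∫ r in Ioi (0 : ℝ), 1 / (1 + q + r) ∂μ := by
  rw [integral_map (by fun_prop) (Measurable.aestronglyMeasurable (by fun_prop)),
    integral_withDensity_eq_integral_toReal_smul (by fun_prop)
      (Eventually.of_forall fun r => ENNReal.ofReal_lt_top)]
  refine setIntegral_congr_fun measurableSet_Ioi fun r hr => ?_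
  have hr : 0 < r := hr
  simp only [smul_eq_mul]
  rw [ENNReal.toReal_ofReal (by positivity)]
  field_simp
  ring

/-- A measure on `]0,∞[` is determined by its Stieltjes transform. -/
theorem eq_of_stieltjes_transform_eq {μ ν : Measure ℝ} (hμ₀ : μ (Iic 0) = 0) (hν₀ : ν (Iic 0) = 0)
    (hμ : ∫⁻ r in Ioi (0 : ℝ), ENNReal.ofReal (1 / (1 + r)) ∂μ < ⊤)
    (hν : ∫⁻ r in Ioi (0 : ℝ), ENNReal.ofReal (1 / (1 + r)) ∂ν < ⊤)
    (h : ∀ p : ℝ, 0 < p → ∫ r in Ioi (0 : ℝ), 1 / (p + r) ∂μ = ∫ r in Ioi (0 : ℝ), 1 / (p + r) ∂ν) :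
    μ = ν := by
  set f : ℝ → ENNReal := fun r => ENNReal.ofReal (1 / (1 + r)) with hf
  have hfin : ∀ m : Measure ℝ, ∫⁻ r in Ioi (0 : ℝ), f r ∂m < ⊤ →
      IsFiniteMeasure ((m.restrict (Ioi 0)).withDensity f) := fun m hm =>
    ⟨by rw [lintegral_one_div_eq]; exact hm⟩
  have := hfin μ hμ
  have := hfin ν hν
  have hmap := eq_of_integral_one_div_eq (ae_map_one_div_mem_Icc μ) (ae_map_one_div_mem_Icc ν)
    (fun q hq => by
      rw [integral_map_one_div μ hq, integral_map_one_div ν hq, h _ (by positivity)])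
  -- Valid for every real r, including r = −1, by the convention 1/0 = 0.
  have hinv : (fun s : ℝ => 1 / s - 1) ∘ (fun r : ℝ => 1 / (1 + r)) = id := by
    ext r; simp
  have hmap2 := congrArg (Measure.map fun s : ℝ => 1 / s - 1) hmap
  rw [Measure.map_map (by fun_prop) (by fun_prop), Measure.map_map (by fun_prop) (by fun_prop),
    hinv, Measure.map_id, Measure.map_id] at hmap2
  -- The weight is positive and finite on ]0,∞[, so it can be divided out.
  have hback : ∀ m : Measure ℝ, m (Iic 0) = 0 →
      ((m.restrict (Ioi 0)).withDensity f).withDensity (fun r => (f r)⁻¹) = m := by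
    intro m hm
    rw [withDensity_inv_same (by fun_prop)]
    · refine Measure.restrict_eq_self_of_ae_mem ?_
      rw [ae_iff]
      simp only [mem_Ioi, not_lt]
      exact hm
    · refine (ae_restrict_iff' measurableSet_Ioi).2 (Eventually.of_forall fun r hr => ?_)
      have hr : 0 < r := hr
      simp only [hf, ne_eq, ENNReal.ofReal_eq_zero, not_le]
      positivity
    · exact Eventually.of_forall fun r => ENNReal.ofReal_ne_top
  rw [← hback μ hμ₀, ← hback ν hν₀, hmap2]

/-! ### An Abelian theorem -/

/-- An Abelian theorem: the behaviour at infinity of the Laplace transform of `h` in terms of the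
behaviour of `h` at `0`. -/
theorem tendsto_mul_laplace {h ψ k D : ℝ → ℝ} {δ : ℝ} (hδ : 0 < δ) (hmeas : Measurable h)
    (hint : IntegrableOn h (Ioi 0))
    (hψ : Tendsto (fun t => ψ t * t * Real.exp (-(δ * t))) atTop (𝓝 0))
    (hD : IntegrableOn (fun s => Real.exp (-s) * D s) (Ioi 0)) (hD₀ : ∀ s, 0 < s → 0 ≤ D s)
    (hbound : ∀ᶠ t in atTop, ∀ s, 0 < s → s < δ * t → |ψ t * h (s / t)| ≤ D s)
    (hlim : ∀ s, 0 < s → Tendsto (fun t => ψ t * h (s / t)) atTop (𝓝 (k s))) :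
    Tendsto (fun t => ψ t * t * ∫ r in Ioi (0 : ℝ), Real.exp (-(r * t)) * h r) atTop
      (𝓝 (∫ s in Ioi (0 : ℝ), Real.exp (-s) * k s)) := by
  -- Below δ the substitution s = rt and domination by D give the limit. Beyond δ the integral is at
  -- most e^(−δt) times the L¹ norm of that piece of h, negligible by `hψ`.
  set h₁ : ℝ → ℝ := (Iio δ).indicator h with hh₁
  set h₂ : ℝ → ℝ := (Ici δ).indicator h with hh₂
  have hsplit : ∀ r, h r = h₁ r + h₂ r := by
    intro r
    simp only [hh₁, hh₂]
    rcases lt_or_ge r δ with hr | hr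
    · rw [indicator_of_mem (show r ∈ Iio δ from hr),
        indicator_of_notMem (show r ∉ Ici δ from not_le.2 hr), add_zero]
    · rw [indicator_of_mem (show r ∈ Ici δ from hr),
        indicator_of_notMem (show r ∉ Iio δ from not_lt.2 hr), zero_add]
  have hm₁ : Measurable h₁ := hmeas.indicator measurableSet_Iio
  have hi₁ : IntegrableOn h₁ (Ioi 0) := hint.indicator measurableSet_Iio
  have hi₂ : IntegrableOn h₂ (Ioi 0) := hint.indicator measurableSet_Ici
  have hexpint : ∀ f : ℝ → ℝ, IntegrableOn f (Ioi 0) → ∀ t : ℝ, 0 < t →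
      IntegrableOn (fun r => Real.exp (-(r * t)) * f r) (Ioi 0) := by
    intro f hf t ht
    refine Integrable.mono hf ((Measurable.aestronglyMeasurable (by fun_prop)).mul
      hf.aestronglyMeasurable) ?_
    refine (ae_restrict_iff' measurableSet_Ioi).2 (Eventually.of_forall fun r hr => ?_)
    rw [norm_mul, Real.norm_of_nonneg (Real.exp_pos _).le]
    exact mul_le_of_le_one_left (norm_nonneg _)
      (Real.exp_le_one_iff.2 (neg_nonpos.2 (mul_pos hr ht).le))
  have hmain : Tendsto (fun t => ∫ s in Ioi (0 : ℝ), Real.exp (-s) * (ψ t * h₁ (s / t))) atTop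
      (𝓝 (∫ s in Ioi (0 : ℝ), Real.exp (-s) * k s)) := by
    refine tendsto_integral_filter_of_dominated_convergence
      (fun s => Real.exp (-s) * D s) ?_ ?_ hD ?_
    · refine Eventually.of_forall fun t => Measurable.aestronglyMeasurable ?_
      fun_prop
    · filter_upwards [hbound, eventually_gt_atTop 0] with t hb ht
      refine (ae_restrict_iff' measurableSet_Ioi).2 (Eventually.of_forall fun s hs => ?_)
      rw [norm_mul, Real.norm_of_nonneg (Real.exp_pos _).le]
      refine mul_le_mul_of_nonneg_left ?_ (Real.exp_pos _).le
      simp only [hh₁]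
      by_cases hst : s / t ∈ Iio δ
      · rw [indicator_of_mem hst]
        exact hb s hs ((div_lt_iff₀ ht).1 hst)
      · rw [indicator_of_notMem hst, mul_zero, norm_zero]
        exact hD₀ s hs
    · refine (ae_restrict_iff' measurableSet_Ioi).2 (Eventually.of_forall fun s hs => ?_)
      refine ((hlim s hs).congr' ?_).const_mul _
      filter_upwards [eventually_gt_atTop (s / δ), eventually_gt_atTop 0] with t ht ht0
      simp only [hh₁]
      rw [indicator_of_mem]
      rw [mem_Iio, div_lt_iff₀ ht0, mul_comm]
      exact (div_lt_iff₀ hδ).1 ht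
  have hrest : Tendsto (fun t => ψ t * t * ∫ r in Ioi (0 : ℝ), Real.exp (-(r * t)) * h₂ r) atTop
      (𝓝 0) := by
    have hb : ∀ᶠ t in atTop, ‖ψ t * t * ∫ r in Ioi (0 : ℝ), Real.exp (-(r * t)) * h₂ r‖ ≤
        |ψ t * t * Real.exp (-(δ * t))| * ∫ r in Ioi (0 : ℝ), ‖h₂ r‖ := by
      filter_upwards [eventually_gt_atTop 0] with t ht
      rw [norm_mul, abs_mul, mul_assoc, ← Real.norm_eq_abs]
      refine mul_le_mul_of_nonneg_left ?_ (norm_nonneg _)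
      rw [← integral_const_mul]
      refine norm_integral_le_of_norm_le (hi₂.norm.const_mul _) ?_
      refine Eventually.of_forall fun r => ?_
      rw [norm_mul, Real.norm_of_nonneg (Real.exp_pos _).le, abs_of_pos (Real.exp_pos _)]
      rcases lt_or_ge r δ with hr | hr
      · simp only [hh₂]
        rw [indicator_of_notMem (show r ∉ Ici δ from not_le.2 hr)]
        simp
      · refine mul_le_mul_of_nonneg_right (Real.exp_le_exp.2 ?_) (norm_nonneg _)
        exact neg_le_neg (mul_le_mul_of_nonneg_right hr ht.le)
    refine squeeze_zero_norm' hb ?_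
    simpa using hψ.abs.mul_const (∫ r in Ioi (0 : ℝ), ‖h₂ r‖)
  have hfin := hmain.add hrest
  rw [add_zero] at hfin
  refine hfin.congr' ?_
  filter_upwards [eventually_gt_atTop 0] with t ht
  have hchange : ∫ s in Ioi (0 : ℝ), Real.exp (-s) * (ψ t * h₁ (s / t)) =
      ψ t * t * ∫ r in Ioi (0 : ℝ), Real.exp (-(r * t)) * h₁ r := by
    have h3 := integral_comp_mul_left_Ioi
      (fun s => Real.exp (-s) * (ψ t * h₁ (s / t))) 0 ht
    rw [mul_zero, smul_eq_mul, eq_inv_mul_iff_mul_eq₀ ht.ne'] at h3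
    rw [← h3, mul_comm (ψ t) t, mul_assoc, ← integral_const_mul (ψ t)]
    congr 1
    refine integral_congr_ae (Eventually.of_forall fun r => ?_)
    simp only
    rw [mul_div_cancel_left₀ _ ht.ne', mul_comm t r]
    ring
  rw [hchange, ← mul_add, ← integral_add (hexpint _ hi₁ t ht) (hexpint _ hi₂ t ht)]
  congr 1
  refine integral_congr_ae (Eventually.of_forall fun r => ?_)
  simp only
  rw [hsplit r]
  ring

theorem isEquivalent_of_tendsto_mul {l : Filter ℝ} {u v φ : ℝ → ℝ} {c : ℝ} (hc : c ≠ 0)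
    (hφ : ∀ᶠ t in l, φ t ≠ 0) (hv : ∀ᶠ t in l, v t = c / φ t)
    (h : Tendsto (fun t => φ t * u t) l (𝓝 c)) : u ~[l] v := by
  refine isEquivalent_of_tendsto_one ?_
  have h2 := h.div_const c
  rw [div_self hc] at h2
  refine h2.congr' ?_
  filter_upwards [hφ, hv] with t h3 h4
  rw [Pi.div_apply, h4]
  field_simp

/-! ### The density near 0 -/

/-- If z = s² then |z| − Re z = 2 (Im s)², and the principal root of such z has Im s ≥ 0. -/
theorem cpow_half_im_eq {z : ℂ} (hz : 0 ≤ z.im) :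
    (z ^ (1 / 2 : ℂ)).im = √((‖z‖ - z.re) / 2) := by
  set s := z ^ (1 / 2 : ℂ) with hs
  have h1 : s ^ 2 = z := by
    simp [hs]
  have h2 : z.re = s.re ^ 2 - s.im ^ 2 := by
    rw [← h1, sq, Complex.mul_re]; ring
  have h3 : ‖z‖ = s.re ^ 2 + s.im ^ 2 := by
    rw [← h1, norm_pow, ← Complex.normSq_eq_norm_sq, Complex.normSq_apply]; ring
  rw [h2, h3, show (s.re ^ 2 + s.im ^ 2 - (s.re ^ 2 - s.im ^ 2)) / 2 = s.im ^ 2 by ring,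
    Real.sqrt_sq (cpow_half_im_nonneg hz)]

/-- The rationalised form avoids the cancellation in |z| − Re z. It is needed for α = 0, where Im z
stays constant while Re z → ∞. -/
theorem cpow_half_im_eq_div {z : ℂ} (hz : 0 < z.im) (hre : 0 ≤ z.re) :
    (z ^ (1 / 2 : ℂ)).im = z.im / √(2 * (‖z‖ + z.re)) := by
  have hn : 0 < ‖z‖ := norm_pos_iff.2 fun h => by simp [h] at hz
  have h1 : ‖z‖ ^ 2 = z.re ^ 2 + z.im ^ 2 := by
    rw [← Complex.normSq_eq_norm_sq, Complex.normSq_apply]; ring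
  rw [cpow_half_im_eq hz.le]
  conv_rhs => rw [← Real.sqrt_sq hz.le, ← Real.sqrt_div (by positivity)]
  congr 1
  rw [div_eq_div_iff (by positivity) (by positivity)]
  linear_combination 2 * h1

section

variable {ρ J₀ M₀ Ω α : ℝ}

theorem attenuationDensity_eq (ρ J₀ M₀ Ω α r : ℝ) : attenuationDensity ρ J₀ M₀ Ω α r =
    √ρ / Real.pi * (sqrtCarson J₀ M₀ Ω α (-(r : ℂ))).im := rfl

theorem one_add_div_neg (Ω r : ℝ) : 1 + (Ω : ℂ) / (-(r : ℂ)) = ((-(Ω / r - 1) : ℝ) : ℂ) := by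
  push_cast
  rw [div_neg]
  ring

theorem carson_neg_im_nonneg (hM₀ : 0 < M₀) (hα₁ : -1 < α) (hα₂ : α < 1) (r : ℝ) :
    0 ≤ (strickMainardiCarson J₀ M₀ Ω α (-(r : ℂ))).im := by
  rw [strickMainardiCarson_eq, one_add_div_neg]
  exact carsonOf_im_nonneg hM₀ hα₁ hα₂ (Complex.ofReal_im _).ge

theorem attenuationDensity_nonneg (hM₀ : 0 < M₀) (hα₁ : -1 < α) (hα₂ : α < 1) (r : ℝ) :
    0 ≤ attenuationDensity ρ J₀ M₀ Ω α r := by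
  have h1 := cpow_half_im_nonneg (carson_neg_im_nonneg (J₀ := J₀) (Ω := Ω) hM₀ hα₁ hα₂ r)
  have := Real.pi_pos
  rw [attenuationDensity]
  positivity

theorem measurable_attenuationDensity (ρ J₀ M₀ Ω α : ℝ) :
    Measurable (attenuationDensity ρ J₀ M₀ Ω α) := by
  have h : Measurable fun r : ℝ => (sqrtCarson J₀ M₀ Ω α (-(r : ℂ))).im :=
    Complex.measurable_im.comp
      ((measurable_sqrtCarson J₀ M₀ Ω α).comp Complex.measurable_ofReal.neg)
  exact h.const_mul _

theorem integrableOn_attenuationDensity (hJ₀ : 0 < J₀) (hM₀ : 0 < M₀) (hΩ : 0 < Ω) (hα₁ : -1 < α)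
    (hα₂ : α < 1) : IntegrableOn (attenuationDensity ρ J₀ M₀ Ω α) (Ioi 0) :=
  (integrableOn_sqrtCarson_neg_im hJ₀ hM₀ hΩ hα₁ hα₂).const_mul _

theorem carson_neg_of_ne_zero (hα : α ≠ 0) {r : ℝ} (hr : 0 < r) (hrΩ : r < Ω) :
    strickMainardiCarson J₀ M₀ Ω α (-(r : ℂ)) = J₀ + M₀ / α * (((Ω / r - 1) ^ α : ℝ) *
      ((Real.cos (Real.pi * α) : ℝ) + (Real.sin (Real.pi * α) : ℝ) * Complex.I) - 1) := by
  have hX : 0 < Ω / r - 1 := by rw [sub_pos, lt_div_iff₀ hr]; linarith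
  rw [strickMainardiCarson_eq, one_add_div_neg, carsonOf, if_neg hα, Complex.cpow_ofReal,
    Complex.arg_ofReal_of_neg (by linarith), Complex.norm_real, norm_neg,
    Real.norm_of_nonneg hX.le]

theorem carson_neg_of_eq_zero {r : ℝ} (hr : 0 < r) (hrΩ : r < Ω) :
    strickMainardiCarson J₀ M₀ Ω 0 (-(r : ℂ)) =
      ((J₀ + M₀ * Real.log (Ω / r - 1) : ℝ) : ℂ) + ((M₀ * Real.pi : ℝ) : ℂ) * Complex.I := by
  have hX : 0 < Ω / r - 1 := by rw [sub_pos, lt_div_iff₀ hr]; linarith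
  have hlog : Complex.log ((-(Ω / r - 1) : ℝ) : ℂ) =
      (Real.log (Ω / r - 1) : ℝ) + (Real.pi : ℝ) * Complex.I := by
    rw [Complex.log, Complex.arg_ofReal_of_neg (by linarith), Complex.norm_real, norm_neg,
      Real.norm_of_nonneg hX.le]
  rw [strickMainardiCarson_eq, one_add_div_neg, carsonOf, if_pos rfl, hlog]
  push_cast
  ring

theorem eventually_mem_Ioo_nhdsGT {b : ℝ} (hb : 0 < b) : ∀ᶠ r : ℝ in 𝓝[>] 0, 0 < r ∧ r < b :=
  Ioo_mem_nhdsGT hb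

/-- Multiplied by r^α, the radicand extends continuously to r = 0 with value (M₀Ω^α/α) e^(iπα). The
constant then comes from (1 − cos πα)/2 = sin²(πα/2). -/
theorem tendsto_rpow_mul_attenuationDensity (hρ : 0 < ρ) (hM₀ : 0 < M₀) (hΩ : 0 < Ω) (hα₀ : 0 < α)
    (hα₂ : α < 1) :
    Tendsto (fun r => r ^ (α / 2) * attenuationDensity ρ J₀ M₀ Ω α r) (𝓝[>] 0)
      (𝓝 (√(ρ * M₀ * Ω ^ α / α) * (Real.sin (α * Real.pi / 2) / Real.pi))) := by
  set E : ℂ := (Real.cos (Real.pi * α) : ℝ) + (Real.sin (Real.pi * α) : ℝ) * Complex.I with hE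
  set Z : ℝ → ℂ := fun r => ((r ^ α : ℝ) : ℂ) * J₀ +
    M₀ / α * ((((Ω - r) ^ α : ℝ) : ℂ) * E - ((r ^ α : ℝ) : ℂ)) with hZ
  have hZc : ContinuousAt Z 0 := by
    have h1 : ContinuousAt (fun r : ℝ => r ^ α) 0 :=
      Real.continuousAt_rpow_const _ _ (Or.inr hα₀.le)
    have h2 : ContinuousAt (fun r : ℝ => (Ω - r) ^ α) 0 :=
      ContinuousAt.rpow_const (by fun_prop) (Or.inr hα₀.le)
    have h3 : ContinuousAt (fun r : ℝ => ((r ^ α : ℝ) : ℂ)) 0 :=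
      Complex.continuous_ofReal.continuousAt.comp h1
    have h4 : ContinuousAt (fun r : ℝ => (((Ω - r) ^ α : ℝ) : ℂ)) 0 :=
      Complex.continuous_ofReal.continuousAt.comp h2
    exact (h3.mul continuousAt_const).add
      (continuousAt_const.mul ((h4.mul continuousAt_const).sub h3))
  set A : ℝ := M₀ * Ω ^ α / α with hA
  have hA0 : 0 < A := by positivity
  have hZ0 : Z 0 = (A : ℂ) * E := by
    simp only [hZ, hA]
    rw [Real.zero_rpow hα₀.ne', sub_zero]
    push_cast
    ring
  have hEn : ‖E‖ = 1 := by
    rw [← sq_eq_sq₀ (norm_nonneg _) zero_le_one, hE, sq_add_sq_eq_norm_sq,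
      Real.cos_sq_add_sin_sq, one_pow]
  have hEre : E.re = Real.cos (Real.pi * α) := by
    rw [hE]; simp [-Complex.ofReal_cos, -Complex.ofReal_sin]
  have hlim : Tendsto (fun r => √ρ / Real.pi * √((‖Z r‖ - (Z r).re) / 2)) (𝓝[>] 0)
      (𝓝 (√ρ / Real.pi * √((‖Z 0‖ - (Z 0).re) / 2))) := by
    have h1 : ContinuousAt (fun r => √ρ / Real.pi * √((‖Z r‖ - (Z r).re) / 2)) 0 :=
      continuousAt_const.mul (Real.continuous_sqrt.continuousAt.comp
        ((hZc.norm.sub (Complex.continuous_re.continuousAt.comp hZc)).div_const 2))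
    exact h1.tendsto.mono_left nhdsWithin_le_nhds
  have hval : √ρ / Real.pi * √((‖Z 0‖ - (Z 0).re) / 2) =
      √(ρ * M₀ * Ω ^ α / α) * (Real.sin (α * Real.pi / 2) / Real.pi) := by
    have hsin : 0 ≤ Real.sin (α * Real.pi / 2) :=
      Real.sin_nonneg_of_nonneg_of_le_pi (by have := Real.pi_pos; positivity)
        (by nlinarith [Real.pi_pos])
    rw [hZ0, norm_mul, hEn, Complex.norm_real, Real.norm_of_nonneg hA0.le, Complex.re_ofReal_mul,
      hEre, show Real.pi * α = 2 * (α * Real.pi / 2) by ring, Real.cos_two_mul,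
      show (A * 1 - A * (2 * Real.cos (α * Real.pi / 2) ^ 2 - 1)) / 2 =
        A * (1 - Real.cos (α * Real.pi / 2) ^ 2) by ring, ← Real.sin_sq,
      Real.sqrt_mul hA0.le, Real.sqrt_sq hsin,
      show ρ * M₀ * Ω ^ α / α = ρ * A by simp only [hA]; ring, Real.sqrt_mul hρ.le]
    ring
  rw [hval] at hlim
  refine hlim.congr' ?_
  filter_upwards [eventually_mem_Ioo_nhdsGT hΩ] with r hr
  have hZr : Z r = ((r ^ α : ℝ) : ℂ) * strickMainardiCarson J₀ M₀ Ω α (-(r : ℂ)) := by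
    rw [carson_neg_of_ne_zero hα₀.ne' hr.1 hr.2,
      show Ω / r - 1 = (Ω - r) / r by have := hr.1.ne'; field_simp,
      Real.div_rpow (by linarith [hr.2]) hr.1.le]
    have hr0 : ((r ^ α : ℝ) : ℂ) ≠ 0 := by exact_mod_cast (Real.rpow_pos_of_pos hr.1 α).ne'
    simp only [hZ, hE, Complex.ofReal_div]
    field_simp
  have hrα : 0 ≤ r ^ α := Real.rpow_nonneg hr.1.le α
  rw [attenuationDensity,
    cpow_half_im_eq (carson_neg_im_nonneg hM₀ (by linarith) hα₂ r), hZr, norm_mul,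
    Complex.norm_real, Real.norm_of_nonneg hrα, Complex.re_ofReal_mul, ← mul_sub, mul_div_assoc,
    Real.sqrt_mul hrα, show α / 2 = α * (1 / 2) by ring, Real.rpow_mul hr.1.le,
    ← Real.sqrt_eq_rpow]
  ring

theorem tendsto_div_sub_one_nhdsGT (hΩ : 0 < Ω) :
    Tendsto (fun r : ℝ => Ω / r - 1) (𝓝[>] 0) atTop := by
  have : Tendsto (fun r : ℝ => Ω / r) (𝓝[>] 0) atTop := by
    simpa [div_eq_mul_inv] using tendsto_inv_nhdsGT_zero.const_mul_atTop hΩ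
  exact tendsto_atTop_add_const_right _ _ this

/-- Here (Ω/r − 1)^α → 0, so the radicand tends to the positive real J₀ − M₀/α, whose root has no
imaginary part. -/
theorem tendsto_attenuationDensity_of_neg (hJ₀ : 0 < J₀) (hM₀ : 0 < M₀) (hΩ : 0 < Ω)
    (hα₁ : -1 < α) (hα₀ : α < 0) :
    Tendsto (attenuationDensity ρ J₀ M₀ Ω α) (𝓝[>] 0) (𝓝 0) := by
  have hX : Tendsto (fun r : ℝ => (Ω / r - 1) ^ α) (𝓝[>] 0) (𝓝 0) := by
    have := (tendsto_rpow_neg_atTop (neg_pos.2 hα₀)).comp (tendsto_div_sub_one_nhdsGT hΩ)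
    simpa [Function.comp_def] using this
  have hX' : Tendsto (fun r : ℝ => (((Ω / r - 1) ^ α : ℝ) : ℂ)) (𝓝[>] 0) (𝓝 0) := by
    have := (Complex.continuous_ofReal.tendsto 0).comp hX
    simpa only [Function.comp_def, Complex.ofReal_zero] using this
  set c : ℝ := J₀ - M₀ / α with hc
  have hc0 : 0 < c := by
    have : M₀ / α < 0 := div_neg_of_pos_of_neg hM₀ hα₀
    linarith
  have hQ : Tendsto (fun r : ℝ => strickMainardiCarson J₀ M₀ Ω α (-(r : ℂ))) (𝓝[>] 0)
      (𝓝 (c : ℂ)) := by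
    have h1 := ((((hX'.mul_const ((Real.cos (Real.pi * α) : ℝ) +
      (Real.sin (Real.pi * α) : ℝ) * Complex.I)).sub_const 1).const_mul
      ((M₀ : ℂ) / α)).const_add (J₀ : ℂ))
    have h2 : (J₀ : ℂ) + (M₀ : ℂ) / α * (0 * ((Real.cos (Real.pi * α) : ℝ) +
      (Real.sin (Real.pi * α) : ℝ) * Complex.I) - 1) = (c : ℂ) := by
      simp only [hc]; push_cast; ring
    rw [h2] at h1
    refine h1.congr' ?_
    filter_upwards [eventually_mem_Ioo_nhdsGT hΩ] with r hr
    rw [carson_neg_of_ne_zero hα₀.ne hr.1 hr.2]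
  have hlim : Tendsto (fun r : ℝ => √ρ / Real.pi *
      √((‖strickMainardiCarson J₀ M₀ Ω α (-(r : ℂ))‖ -
        (strickMainardiCarson J₀ M₀ Ω α (-(r : ℂ))).re) / 2)) (𝓝[>] 0)
      (𝓝 (√ρ / Real.pi * √((‖(c : ℂ)‖ - (c : ℂ).re) / 2))) :=
    (((hQ.norm.sub ((Complex.continuous_re.tendsto _).comp hQ)).div_const 2).sqrt).const_mul _
  rw [Complex.norm_real, Real.norm_of_nonneg hc0.le, Complex.ofReal_re, sub_self, zero_div,
    Real.sqrt_zero, mul_zero] at hlim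
  refine hlim.congr fun r => ?_
  rw [attenuationDensity, cpow_half_im_eq (carson_neg_im_nonneg hM₀ hα₁ (by linarith) r)]

/-- With L = log(Ω/r − 1), the radicand is L·Z with Z → M₀, and its imaginary part is M₀π. The limit
is √ρ M₀/√(4M₀), the π cancelling that of h. -/
theorem tendsto_sqrt_log_mul_attenuationDensity (hρ : 0 < ρ) (hJ₀ : 0 < J₀) (hM₀ : 0 < M₀)
    (hΩ : 0 < Ω) :
    Tendsto (fun r => √(Real.log (Ω / r - 1)) * attenuationDensity ρ J₀ M₀ Ω 0 r) (𝓝[>] 0)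
      (𝓝 (√(ρ * M₀) / 2)) := by
  have hL := Real.tendsto_log_atTop.comp (tendsto_div_sub_one_nhdsGT hΩ)
  set Z : ℝ → ℂ := fun L => ((J₀ / L + M₀ : ℝ) : ℂ) + ((M₀ * Real.pi / L : ℝ) : ℂ) * Complex.I
    with hZ
  have hZlim : Tendsto Z atTop (𝓝 (M₀ : ℂ)) := by
    have h1 : Tendsto (fun L : ℝ => J₀ / L + M₀) atTop (𝓝 (0 + M₀)) :=
      (tendsto_const_nhds.div_atTop tendsto_id).add_const _
    have h2 : Tendsto (fun L : ℝ => M₀ * Real.pi / L) atTop (𝓝 0) :=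
      tendsto_const_nhds.div_atTop tendsto_id
    have h3 := ((Complex.continuous_ofReal.tendsto _).comp h1).add
      (((Complex.continuous_ofReal.tendsto _).comp h2).mul_const Complex.I)
    simpa [Function.comp_def, hZ] using h3
  have hlim : Tendsto (fun L : ℝ => √ρ * M₀ / √(2 * (‖Z L‖ + (Z L).re))) atTop
      (𝓝 (√ρ * M₀ / √(2 * (‖(M₀ : ℂ)‖ + (M₀ : ℂ).re)))) := by
    refine tendsto_const_nhds.div
      (((hZlim.norm.add ((Complex.continuous_re.tendsto _).comp hZlim)).const_mul 2).sqrt) ?_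
    rw [Complex.norm_real, Real.norm_of_nonneg hM₀.le, Complex.ofReal_re]
    positivity
  have hval : √ρ * M₀ / √(2 * (‖(M₀ : ℂ)‖ + (M₀ : ℂ).re)) = √(ρ * M₀) / 2 := by
    rw [Complex.norm_real, Real.norm_of_nonneg hM₀.le, Complex.ofReal_re,
      show 2 * (M₀ + M₀) = 2 ^ 2 * M₀ by ring, Real.sqrt_mul (by positivity),
      Real.sqrt_sq (by norm_num), Real.sqrt_mul hρ.le]
    have h := Real.mul_self_sqrt hM₀.le
    have h2 := Real.sqrt_pos.2 hM₀
    field_simp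
    linear_combination -h
  rw [hval] at hlim
  refine (hlim.comp hL).congr' ?_
  filter_upwards [eventually_mem_Ioo_nhdsGT hΩ, hL.eventually_gt_atTop 0] with r hr hL0
  simp only [Function.comp_apply] at hL0 ⊢
  set L := Real.log (Ω / r - 1) with hLdef
  have hQ : strickMainardiCarson J₀ M₀ Ω 0 (-(r : ℂ)) = (L : ℂ) * Z L := by
    rw [carson_neg_of_eq_zero hr.1 hr.2, ← hLdef]
    have : (L : ℂ) ≠ 0 := by exact_mod_cast hL0.ne'
    simp only [hZ]
    push_cast
    field_simp
  have him : (strickMainardiCarson J₀ M₀ Ω 0 (-(r : ℂ))).im = M₀ * Real.pi := by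
    rw [carson_neg_of_eq_zero hr.1 hr.2]; simp
  have hre : (strickMainardiCarson J₀ M₀ Ω 0 (-(r : ℂ))).re = J₀ + M₀ * L := by
    rw [carson_neg_of_eq_zero hr.1 hr.2]; simp [← hLdef]
  have hpi := Real.pi_pos
  rw [attenuationDensity, cpow_half_im_eq_div (by rw [him]; positivity) (by rw [hre]; positivity),
    him, hQ, norm_mul, Complex.norm_real, Real.norm_of_nonneg hL0.le, Complex.re_ofReal_mul,
    ← mul_add, mul_left_comm 2 L, Real.sqrt_mul hL0.le]
  have hsL := Real.sqrt_pos.2 hL0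
  field_simp

end

/-! ### The measure, the wavenumber and the function g -/

section

variable {ρ J₀ M₀ Ω α : ℝ}

/-- The dispersion-attenuation measure of the Strick-Mainardi medium. -/
noncomputable def attenuationMeasure (ρ J₀ M₀ Ω α : ℝ) : Measure ℝ :=
  (volume.restrict (Ioi (0 : ℝ))).withDensity
    (fun r => ENNReal.ofReal (attenuationDensity ρ J₀ M₀ Ω α r))

theorem setIntegral_attenuationMeasure (hM₀ : 0 < M₀) (hα₁ : -1 < α) (hα₂ : α < 1) (f : ℝ → ℝ) :
    ∫ r in Ioi (0 : ℝ), f r ∂(attenuationMeasure ρ J₀ M₀ Ω α) =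
      ∫ r in Ioi (0 : ℝ), f r * attenuationDensity ρ J₀ M₀ Ω α r := by
  rw [attenuationMeasure, restrict_withDensity measurableSet_Ioi,
    Measure.restrict_restrict measurableSet_Ioi, inter_self,
    integral_withDensity_eq_integral_toReal_smul
      (measurable_attenuationDensity ρ J₀ M₀ Ω α).ennreal_ofReal
      (Eventually.of_forall fun r => ENNReal.ofReal_lt_top)]
  congr 1
  ext r
  rw [ENNReal.toReal_ofReal (attenuationDensity_nonneg hM₀ hα₁ hα₂ r), smul_eq_mul, mul_comm]

theorem relaxationG_attenuationMeasure (hM₀ : 0 < M₀) (hα₁ : -1 < α) (hα₂ : α < 1) (t : ℝ) :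
    relaxationG (attenuationMeasure ρ J₀ M₀ Ω α) t =
      ∫ r in Ioi (0 : ℝ), Real.exp (-(r * t)) * attenuationDensity ρ J₀ M₀ Ω α r :=
  setIntegral_attenuationMeasure hM₀ hα₁ hα₂ _

theorem wavenumber_eq (hρ : 0 < ρ) (hJ₀ : 0 < J₀) (hM₀ : 0 < M₀) (hΩ : 0 < Ω) (hα₁ : -1 < α)
    (hα₂ : α < 1) {p : ℝ} (hp : 0 < p) :
    wavenumber ρ (strickMainardiCreep J₀ M₀ Ω α) p = p * √(ρ * J₀) +
      p * ∫ r in Ioi (0 : ℝ), 1 / (p + r) ∂(attenuationMeasure ρ J₀ M₀ Ω α) := by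
  have h : ∫ r in Ioi (0 : ℝ), 1 / (p + r) ∂(attenuationMeasure ρ J₀ M₀ Ω α) =
      √ρ / Real.pi * ∫ r in Ioi (0 : ℝ), (sqrtCarson J₀ M₀ Ω α (-(r : ℂ))).im / (p + r) := by
    rw [setIntegral_attenuationMeasure hM₀ hα₁ hα₂, ← integral_const_mul]
    congr 1
    ext r
    rw [attenuationDensity_eq]
    ring
  rw [h, wavenumber, sqrt_mul_laplaceTransform_eq hJ₀ hM₀ hΩ hα₁ hα₂ hp, Real.sqrt_mul hρ.le]
  ring

theorem tendsto_wavenumber_div (hρ : 0 < ρ) (hJ₀ : 0 < J₀) (hM₀ : 0 < M₀) (hΩ : 0 < Ω)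
    (hα₁ : -1 < α) (hα₂ : α < 1) :
    Tendsto (fun p : ℝ => wavenumber ρ (strickMainardiCreep J₀ M₀ Ω α) p / p) atTop
      (𝓝 √(ρ * J₀)) := by
  obtain ⟨K, R, -, hdec⟩ := exists_norm_sqrtCarson_sub_le (M₀ := M₀) (Ω := Ω) (α := α) hJ₀
  have h1 : Tendsto (fun p : ℝ => √(p * laplaceTransform (strickMainardiCreep J₀ M₀ Ω α) p))
      atTop (𝓝 √J₀) := by
    rw [tendsto_iff_norm_sub_tendsto_zero]
    refine squeeze_zero' (Eventually.of_forall fun _ => norm_nonneg _) ?_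
      (tendsto_const_nhds.div_atTop tendsto_id : Tendsto (fun p : ℝ => K / p) atTop (𝓝 0))
    filter_upwards [eventually_gt_atTop 0, eventually_ge_atTop R] with p hp hpR
    have hn : ‖(p : ℂ)‖ = p := by rw [Complex.norm_real, Real.norm_of_nonneg hp.le]
    have h := hdec p (by rw [hn]; exact hpR)
    rwa [sqrtCarson_ofReal hJ₀ hM₀ hΩ hα₁ hα₂ hp, ← Complex.ofReal_sub, Complex.norm_real,
      hn] at h
  rw [Real.sqrt_mul hρ.le]
  refine (h1.const_mul √ρ).congr' ?_
  filter_upwards [eventually_gt_atTop 0] with p hp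
  rw [wavenumber]
  field_simp

theorem isAttenuationMeasure_attenuationMeasure (hρ : 0 < ρ) (hJ₀ : 0 < J₀) (hM₀ : 0 < M₀)
    (hΩ : 0 < Ω) (hα₁ : -1 < α) (hα₂ : α < 1) :
    IsAttenuationMeasure ρ (strickMainardiCreep J₀ M₀ Ω α) (1 / √(ρ * J₀))
      (attenuationMeasure ρ J₀ M₀ Ω α) where
  speed_pos := by positivity
  tendsto_speed := by
    rw [one_div_one_div]
    exact tendsto_wavenumber_div hρ hJ₀ hM₀ hΩ hα₁ hα₂
  support := by
    rw [attenuationMeasure, withDensity_apply _ measurableSet_Iic,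
      Measure.restrict_restrict measurableSet_Iic, Iic_inter_Ioi, Ioc_self, Measure.restrict_empty,
      lintegral_zero_measure]
  lintegral_lt_top := by
    -- The measure is even finite, as h is integrable.
    refine lt_of_le_of_lt (b := attenuationMeasure ρ J₀ M₀ Ω α univ) ?_ ?_
    · refine (setLIntegral_mono' (g := fun _ => 1) measurableSet_Ioi fun r hr => ?_).trans ?_
      · have hr : 0 < r := hr
        rw [ENNReal.ofReal_le_one, div_le_one (by positivity)]
        linarith
      · rw [setLIntegral_one]
        exact measure_mono (subset_univ _)
    · rw [attenuationMeasure, withDensity_apply _ MeasurableSet.univ, Measure.restrict_univ]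
      exact (integrableOn_attenuationDensity hJ₀ hM₀ hΩ hα₁ hα₂).lintegral_lt_top
  representation p hp := by
    rw [wavenumber_eq hρ hJ₀ hM₀ hΩ hα₁ hα₂ hp, div_div_eq_mul_div, div_one]

/-- Scaling by ψ(t) = t^(−α/2) turns h(s/t) into s^(−α/2) times a factor tending to C and bounded by
|C| + 1 near 0. The limit integral is Euler's Γ(1 − α/2). -/
theorem tendsto_relaxationG_of_pos (hρ : 0 < ρ) (hJ₀ : 0 < J₀) (hM₀ : 0 < M₀) (hΩ : 0 < Ω)
    (hα₀ : 0 < α) (hα₂ : α < 1) :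
    Tendsto (fun t => t ^ (1 - α / 2) * relaxationG (attenuationMeasure ρ J₀ M₀ Ω α) t) atTop
      (𝓝 (Real.Gamma (1 - α / 2) *
        (√(ρ * M₀ * Ω ^ α / α) * (Real.sin (α * Real.pi / 2) / Real.pi)))) := by
  have hα₁ : -1 < α := by linarith
  set C : ℝ := √(ρ * M₀ * Ω ^ α / α) * (Real.sin (α * Real.pi / 2) / Real.pi) with hC
  have hlim := tendsto_rpow_mul_attenuationDensity (J₀ := J₀) hρ hM₀ hΩ hα₀ hα₂
  rw [← hC] at hlim
  obtain ⟨δ, hδ, hδb⟩ := mem_nhdsGT_iff_exists_Ioo_subset.1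
    (hlim.abs.eventually_lt_const (lt_add_one |C|))
  have hδ : 0 < δ := hδ
  have hscale : ∀ s t : ℝ, 0 < s → 0 < t → t ^ (-(α / 2)) * attenuationDensity ρ J₀ M₀ Ω α (s / t) =
      s ^ (-(α / 2)) * ((s / t) ^ (α / 2) * attenuationDensity ρ J₀ M₀ Ω α (s / t)) := by
    intro s t hs ht
    rw [Real.div_rpow hs.le ht.le, Real.rpow_neg hs.le, Real.rpow_neg ht.le]
    have := Real.rpow_pos_of_pos hs (α / 2)
    have := Real.rpow_pos_of_pos ht (α / 2)
    field_simp
  have hG := Real.GammaIntegral_convergent (s := 1 - α / 2) (by linarith)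
  simp only [sub_sub_cancel_left] at hG
  have key := tendsto_mul_laplace (h := attenuationDensity ρ J₀ M₀ Ω α)
    (ψ := fun t => t ^ (-(α / 2))) (k := fun s => C * s ^ (-(α / 2)))
    (D := fun s => (|C| + 1) * s ^ (-(α / 2))) hδ
    (measurable_attenuationDensity ρ J₀ M₀ Ω α)
    (integrableOn_attenuationDensity hJ₀ hM₀ hΩ hα₁ hα₂) ?_ ?_ ?_ ?_ ?_
  · have hval : ∫ s in Ioi (0 : ℝ), Real.exp (-s) * (C * s ^ (-(α / 2))) =
        Real.Gamma (1 - α / 2) * C := by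
      rw [Real.Gamma_eq_integral (by linarith), ← integral_mul_const, sub_sub_cancel_left]
      congr 1
      ext s
      ring
    rw [hval] at key
    refine key.congr' ?_
    filter_upwards [eventually_gt_atTop 0] with t ht
    rw [relaxationG_attenuationMeasure hM₀ hα₁ hα₂, sub_eq_neg_add, Real.rpow_add ht, Real.rpow_one]
  · refine (tendsto_rpow_mul_exp_neg_mul_atTop_nhds_zero (1 - α / 2) δ hδ).congr' ?_
    filter_upwards [eventually_gt_atTop 0] with t ht
    rw [sub_eq_neg_add, Real.rpow_add ht, Real.rpow_one, neg_mul]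
  · refine (hG.const_mul (|C| + 1)).congr (Eventually.of_forall fun s => ?_)
    simp only
    ring
  · intro s hs
    positivity
  · filter_upwards [eventually_gt_atTop 0] with t ht s hs hst
    rw [hscale s t hs ht, abs_mul, abs_of_pos (Real.rpow_pos_of_pos hs _), mul_comm]
    refine mul_le_mul_of_nonneg_right (le_of_lt ?_) (Real.rpow_nonneg hs.le _)
    exact hδb ⟨div_pos hs ht, (div_lt_iff₀ ht).2 hst⟩
  · intro s hs
    have h0 : Tendsto (fun t : ℝ => s / t) atTop (𝓝[>] 0) := by
      refine tendsto_nhdsWithin_iff.2 ⟨tendsto_const_nhds.div_atTop tendsto_id, ?_⟩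
      filter_upwards [eventually_gt_atTop 0] with t ht
      exact div_pos hs ht
    rw [mul_comm C]
    refine ((hlim.comp h0).const_mul (s ^ (-(α / 2)))).congr' ?_
    filter_upwards [eventually_gt_atTop 0] with t ht
    exact (hscale s t hs ht).symm

theorem tendsto_relaxationG_of_neg (hJ₀ : 0 < J₀) (hM₀ : 0 < M₀) (hΩ : 0 < Ω) (hα₁ : -1 < α)
    (hα₀ : α < 0) :
    Tendsto (fun t => t * relaxationG (attenuationMeasure ρ J₀ M₀ Ω α) t) atTop (𝓝 0) := by
  have hα₂ : α < 1 := by linarith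
  have hlim := tendsto_attenuationDensity_of_neg (ρ := ρ) hJ₀ hM₀ hΩ hα₁ hα₀
  obtain ⟨δ, hδ, hδb⟩ := mem_nhdsGT_iff_exists_Ioo_subset.1
    (hlim.abs.eventually_lt_const (by simp : |(0 : ℝ)| < 1))
  have hδ : 0 < δ := hδ
  have key := tendsto_mul_laplace (h := attenuationDensity ρ J₀ M₀ Ω α)
    (ψ := fun _ => 1) (k := fun _ => 0) (D := fun _ => 1) hδ
    (measurable_attenuationDensity ρ J₀ M₀ Ω α)
    (integrableOn_attenuationDensity hJ₀ hM₀ hΩ hα₁ hα₂) ?_ ?_ (fun _ _ => zero_le_one) ?_ ?_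
  · simp only [one_mul, mul_zero, integral_zero] at key
    simpa only [relaxationG_attenuationMeasure hM₀ hα₁ hα₂] using key
  · simpa using tendsto_rpow_mul_exp_neg_mul_atTop_nhds_zero 1 δ hδ
  · simpa using integrableOn_exp_neg_mul_Ioi one_pos
  · filter_upwards [eventually_gt_atTop 0] with t ht s hs hst
    rw [one_mul]
    exact le_of_lt (hδb ⟨div_pos hs ht, (div_lt_iff₀ ht).2 hst⟩)
  · intro s hs
    have h0 : Tendsto (fun t : ℝ => s / t) atTop (𝓝[>] 0) := by
      refine tendsto_nhdsWithin_iff.2 ⟨tendsto_const_nhds.div_atTop tendsto_id, ?_⟩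
      filter_upwards [eventually_gt_atTop 0] with t ht
      exact div_pos hs ht
    simpa [Function.comp_def] using hlim.comp h0

/-- Domination for the logarithmic case, with r = s/t: log(Ωt) = log(Ω/2r) + log(2s). For r ≤ Ω/8
one has e < 4 ≤ Ω/2r ≤ Ω/r − 1, so the last logarithm is at least 1 and absorbs log(2s) ≤ 2s. -/
theorem log_le_log_mul_one_add {Ω r t s : ℝ} (hr : 0 < r) (hrΩ : r ≤ Ω / 8) (hs : 0 < s)
    (hΩt : Ω * t = Ω / r * s) :
    Real.log (Ω * t) ≤ Real.log (Ω / r - 1) * (1 + 2 * s) := by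
  have hΩ : 0 < Ω := by linarith
  have h8 : 8 ≤ Ω / r := by rw [le_div_iff₀ hr]; linarith
  have h1 : 1 ≤ Real.log (Ω / (2 * r)) := by
    rw [Real.le_log_iff_exp_le (by positivity)]
    have : Ω / (2 * r) = Ω / r / 2 := by field_simp
    rw [this]
    linarith [Real.exp_one_lt_d9]
  have h2 : Real.log (Ω / (2 * r)) ≤ Real.log (Ω / r - 1) := by
    refine Real.log_le_log (by positivity) ?_
    have : Ω / (2 * r) = Ω / r / 2 := by field_simp
    linarith
  have h3 : Real.log (Ω * t) = Real.log (Ω / (2 * r)) + Real.log (2 * s) := by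
    rw [← Real.log_mul (by positivity) (by positivity), hΩt]
    congr 1
    field_simp
  have h4 : Real.log (2 * s) ≤ 2 * s := (Real.log_le_sub_one_of_pos (by positivity)).trans (by linarith)
  rw [h3]
  nlinarith [mul_nonneg (by linarith : 0 ≤ Real.log (Ω / r - 1) - 1) hs.le]

/-- Slow variation: Ωt/s − 1 = Ωt(1/s − 1/(Ωt)), so the two logarithms differ by a convergent term.
-/
theorem tendsto_log_ratio (hΩ : 0 < Ω) {s : ℝ} (hs : 0 < s) :
    Tendsto (fun t => Real.log (Ω * t) / Real.log (Ω / (s / t) - 1)) atTop (𝓝 1) := by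
  have hlog : Tendsto (fun t => Real.log (Ω * t)) atTop atTop :=
    Real.tendsto_log_atTop.comp (tendsto_id.const_mul_atTop hΩ)
  have h1 : Tendsto (fun t : ℝ => 1 / s - 1 / (Ω * t)) atTop (𝓝 (1 / s)) := by
    have : Tendsto (fun t : ℝ => 1 / (Ω * t)) atTop (𝓝 0) :=
      tendsto_const_nhds.div_atTop (tendsto_id.const_mul_atTop hΩ)
    simpa using this.const_sub (1 / s)
  have h2 : Tendsto (fun t : ℝ => Real.log (1 / s - 1 / (Ω * t)) / Real.log (Ω * t)) atTop
      (𝓝 0) := (h1.log (by positivity)).div_atTop hlog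
  have h3 := (h2.const_add 1).inv₀ (by norm_num)
  rw [add_zero, inv_one] at h3
  refine h3.congr' ?_
  filter_upwards [hlog.eventually_gt_atTop 0, eventually_gt_atTop 0,
    h1.eventually_const_lt (by positivity : 0 < 1 / s)] with t hlt ht hpos
  have h4 : Ω / (s / t) - 1 = (Ω * t) * (1 / s - 1 / (Ω * t)) := by field_simp
  rw [h4, Real.log_mul (by positivity) hpos.ne', ← inv_div]
  field_simp

/-- By slow variation the rescaled density tends to the constant C for every s, with a majorant
linear in s, and ∫ e^(−s) ds = 1. -/
theorem tendsto_relaxationG_of_eq_zero (hρ : 0 < ρ) (hJ₀ : 0 < J₀) (hM₀ : 0 < M₀) (hΩ : 0 < Ω) :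
    Tendsto (fun t => √(Real.log (Ω * t)) * t *
      relaxationG (attenuationMeasure ρ J₀ M₀ Ω 0) t) atTop (𝓝 (√(ρ * M₀) / 2)) := by
  have hα₁ : (-1 : ℝ) < 0 := by norm_num
  have hα₂ : (0 : ℝ) < 1 := by norm_num
  set C : ℝ := √(ρ * M₀) / 2 with hC
  have hlim := tendsto_sqrt_log_mul_attenuationDensity hρ hJ₀ hM₀ hΩ
  rw [← hC] at hlim
  obtain ⟨δ', hδ', hδb⟩ := mem_nhdsGT_iff_exists_Ioo_subset.1
    (hlim.abs.eventually_lt_const (lt_add_one |C|))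
  have hδ' : 0 < δ' := hδ'
  set δ : ℝ := min δ' (Ω / 8) with hδdef
  have hδ : 0 < δ := lt_min hδ' (by positivity)
  have hlog : Tendsto (fun t => Real.log (Ω * t)) atTop atTop :=
    Real.tendsto_log_atTop.comp (tendsto_id.const_mul_atTop hΩ)
  have key := tendsto_mul_laplace (h := attenuationDensity ρ J₀ M₀ Ω 0)
    (ψ := fun t => √(Real.log (Ω * t))) (k := fun _ => C)
    (D := fun s => (|C| + 1) * (1 + 2 * s)) hδ
    (measurable_attenuationDensity ρ J₀ M₀ Ω 0)
    (integrableOn_attenuationDensity hJ₀ hM₀ hΩ hα₁ hα₂) ?_ ?_ ?_ ?_ ?_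
  · have hval : ∫ s in Ioi (0 : ℝ), Real.exp (-s) * C = C := by
      rw [integral_mul_const, integral_exp_neg_Ioi_zero, one_mul]
    rw [hval] at key
    simpa only [relaxationG_attenuationMeasure hM₀ hα₁ hα₂] using key
  · have h1 := (tendsto_rpow_mul_exp_neg_mul_atTop_nhds_zero 2 δ hδ).const_mul Ω
    rw [mul_zero] at h1
    refine squeeze_zero_norm' ?_ h1
    filter_upwards [eventually_gt_atTop 0, hlog.eventually_ge_atTop 1] with t ht hlt
    rw [norm_mul, norm_mul, Real.norm_of_nonneg (Real.sqrt_nonneg _), Real.norm_of_nonneg ht.le,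
      Real.norm_of_nonneg (Real.exp_pos _).le, neg_mul]
    have h2 : √(Real.log (Ω * t)) ≤ Ω * t := by
      refine (Real.sqrt_le_left (by positivity)).2 ?_
      have := Real.log_le_sub_one_of_pos (mul_pos hΩ ht)
      nlinarith
    have h3 : t ^ (2 : ℝ) = t * t := by rw [Real.rpow_two, sq]
    rw [h3, show Ω * (t * t * Real.exp (-(δ * t))) = Ω * t * t * Real.exp (-(δ * t)) by ring]
    gcongr
  · have h0 := integrableOn_pow_mul_exp_neg one_pos 0
    have h1 := integrableOn_pow_mul_exp_neg one_pos 1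
    refine ((h0.add (h1.const_mul 2)).const_mul (|C| + 1)).congr
      (Eventually.of_forall fun s => ?_)
    simp only [Pi.add_apply, pow_zero, pow_one, one_mul]
    ring
  · intro s hs
    positivity
  · filter_upwards [eventually_gt_atTop 0] with t ht s hs hst
    have hr : 0 < s / t := div_pos hs ht
    have hrδ : s / t < δ := (div_lt_iff₀ ht).2 hst
    have hb : |√(Real.log (Ω / (s / t) - 1)) * attenuationDensity ρ J₀ M₀ Ω 0 (s / t)| <
        |C| + 1 := hδb ⟨hr, hrδ.trans_le (min_le_left _ _)⟩
    have hl := log_le_log_mul_one_add hr (hrδ.le.trans (min_le_right _ _)) hs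
      (t := t) (by field_simp)
    have hsq : √(Real.log (Ω * t)) ≤ √(Real.log (Ω / (s / t) - 1)) * (1 + 2 * s) := by
      refine (Real.sqrt_le_sqrt hl).trans ?_
      rw [Real.sqrt_mul' _ (by positivity)]
      refine mul_le_mul_of_nonneg_left ?_ (Real.sqrt_nonneg _)
      refine (Real.sqrt_le_left (by positivity)).2 ?_
      nlinarith
    rw [abs_mul, abs_of_nonneg (Real.sqrt_nonneg _)] at hb ⊢
    calc √(Real.log (Ω * t)) * |attenuationDensity ρ J₀ M₀ Ω 0 (s / t)|
        ≤ √(Real.log (Ω / (s / t) - 1)) * (1 + 2 * s) *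
          |attenuationDensity ρ J₀ M₀ Ω 0 (s / t)| :=
          mul_le_mul_of_nonneg_right hsq (abs_nonneg _)
      _ = √(Real.log (Ω / (s / t) - 1)) * |attenuationDensity ρ J₀ M₀ Ω 0 (s / t)| *
          (1 + 2 * s) := by ring
      _ ≤ (|C| + 1) * (1 + 2 * s) := mul_le_mul_of_nonneg_right hb.le (by positivity)
  · intro s hs
    have h0 : Tendsto (fun t : ℝ => s / t) atTop (𝓝[>] 0) := by
      refine tendsto_nhdsWithin_iff.2 ⟨tendsto_const_nhds.div_atTop tendsto_id, ?_⟩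
      filter_upwards [eventually_gt_atTop 0] with t ht
      exact div_pos hs ht
    have h1 := (tendsto_log_ratio hΩ hs).sqrt.mul (hlim.comp h0)
    rw [Real.sqrt_one, one_mul] at h1
    have hL : ∀ᶠ t : ℝ in atTop, 0 < Real.log (Ω / (s / t) - 1) :=
      ((Real.tendsto_log_atTop.comp (tendsto_div_sub_one_nhdsGT hΩ)).comp h0).eventually_gt_atTop 0
    refine h1.congr' ?_
    filter_upwards [hL] with t ht
    simp only [Function.comp_apply]
    rw [Real.sqrt_div' _ ht.le, ← mul_assoc, div_mul_cancel₀ _ (Real.sqrt_pos.2 ht).ne']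

end

/-! ### Assembly -/

theorem mainTheorem5 (ρ J₀ M₀ Ω α : ℝ) (hρ : 0 < ρ) (hJ₀ : 0 < J₀) (hM₀ : 0 < M₀) (hΩ : 0 < Ω)
    (hα₁ : -1 < α) (hα₂ : α < 1) :
    ∃ ν : Measure ℝ,
      IsAttenuationMeasure ρ (strickMainardiCreep J₀ M₀ Ω α) (1 / √(ρ * J₀)) ν ∧
      (∀ (c : ℝ) (ν' : Measure ℝ),
        IsAttenuationMeasure ρ (strickMainardiCreep J₀ M₀ Ω α) c ν' → ν' = ν) ∧
      ν = (volume.restrict (Ioi (0 : ℝ))).withDensity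
        (fun r => ENNReal.ofReal (attenuationDensity ρ J₀ M₀ Ω α r)) ∧
      (∀ r : ℝ, 0 < r → 0 ≤ attenuationDensity ρ J₀ M₀ Ω α r) ∧
      (0 < α →
        (attenuationDensity ρ J₀ M₀ Ω α ~[𝓝[>] 0]
          fun r => √(ρ * M₀ * Ω ^ α / α) * (Real.sin (α * Real.pi / 2) / Real.pi) *
            r ^ (-(α / 2))) ∧
        (relaxationG ν ~[atTop]
          fun t => Real.Gamma (1 - α / 2) *
            (√(ρ * M₀ * Ω ^ α / α) * (Real.sin (α * Real.pi / 2) / Real.pi)) *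
            t ^ (α / 2 - 1))) ∧
      (α < 0 →
        Tendsto (attenuationDensity ρ J₀ M₀ Ω α) (𝓝[>] 0) (𝓝 0) ∧
        Tendsto (fun t : ℝ => t * relaxationG ν t) atTop (𝓝 0)) ∧
      (α = 0 →
        (attenuationDensity ρ J₀ M₀ Ω α ~[𝓝[>] 0]
          fun r => √(ρ * M₀) / 2 / √(Real.log (Ω / r - 1))) ∧
        (relaxationG ν ~[atTop]
          fun t => √(ρ * M₀) / 2 / (t * √(Real.log (Ω * t))))) := by
  have hν := isAttenuationMeasure_attenuationMeasure hρ hJ₀ hM₀ hΩ hα₁ hα₂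
  refine ⟨attenuationMeasure ρ J₀ M₀ Ω α, hν, ?_, rfl,
    fun r _ => attenuationDensity_nonneg hM₀ hα₁ hα₂ r, ?_, ?_, ?_⟩
  · intro c ν' hν'
    -- The speed c is forced by the limit of κ(p)/p, so the linear terms cancel and the Stieltjes
    -- transforms agree.
    have hc := tendsto_nhds_unique hν'.tendsto_speed hν.tendsto_speed
    refine eq_of_stieltjes_transform_eq hν'.support hν.support hν'.lintegral_lt_top
      hν.lintegral_lt_top fun p hp => ?_
    have h1 := hν'.representation p hp
    rw [hν.representation p hp, ← mul_one_div, ← mul_one_div p c, hc] at h1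
    exact (mul_left_cancel₀ hp.ne' (add_left_cancel h1)).symm
  · intro hα₀
    have hC : √(ρ * M₀ * Ω ^ α / α) * (Real.sin (α * Real.pi / 2) / Real.pi) ≠ 0 := by
      have hsin : 0 < Real.sin (α * Real.pi / 2) :=
        Real.sin_pos_of_pos_of_lt_pi (by have := Real.pi_pos; positivity)
          (by nlinarith [Real.pi_pos])
      have := Real.pi_pos
      positivity
    have hG : Real.Gamma (1 - α / 2) ≠ 0 := (Real.Gamma_pos_of_pos (by linarith)).ne'
    constructor
    · refine isEquivalent_of_tendsto_mul (φ := fun r => r ^ (α / 2)) hC ?_ ?_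
        (tendsto_rpow_mul_attenuationDensity hρ hM₀ hΩ hα₀ hα₂)
      · filter_upwards [self_mem_nhdsWithin] with r hr
        exact (Real.rpow_pos_of_pos hr _).ne'
      · filter_upwards [self_mem_nhdsWithin] with r hr
        rw [Real.rpow_neg (le_of_lt hr), ← div_eq_mul_inv]
    · refine isEquivalent_of_tendsto_mul (φ := fun t => t ^ (1 - α / 2)) (mul_ne_zero hG hC) ?_ ?_
        (tendsto_relaxationG_of_pos hρ hJ₀ hM₀ hΩ hα₀ hα₂)
      · filter_upwards [eventually_gt_atTop 0] with t ht
        exact (Real.rpow_pos_of_pos ht _).ne'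
      · filter_upwards [eventually_gt_atTop 0] with t ht
        rw [← neg_sub 1 (α / 2), Real.rpow_neg ht.le, ← div_eq_mul_inv]
  · intro hα₀
    exact ⟨tendsto_attenuationDensity_of_neg hJ₀ hM₀ hΩ hα₁ hα₀,
      tendsto_relaxationG_of_neg hJ₀ hM₀ hΩ hα₁ hα₀⟩
  · rintro rfl
    have hC : √(ρ * M₀) / 2 ≠ 0 := by positivity
    constructor
    · refine isEquivalent_of_tendsto_mul (φ := fun r => √(Real.log (Ω / r - 1))) hC ?_
        (Eventually.of_forall fun r => rfl)
        (tendsto_sqrt_log_mul_attenuationDensity hρ hJ₀ hM₀ hΩ)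
      filter_upwards [(Real.tendsto_log_atTop.comp
        (tendsto_div_sub_one_nhdsGT hΩ)).eventually_gt_atTop 0] with r hr
      exact (Real.sqrt_pos.2 hr).ne'
    · refine isEquivalent_of_tendsto_mul (φ := fun t => √(Real.log (Ω * t)) * t) hC ?_
        (Eventually.of_forall fun t => by rw [mul_comm t])
        (tendsto_relaxationG_of_eq_zero hρ hJ₀ hM₀ hΩ)
      filter_upwards [eventually_gt_atTop 0, (Real.tendsto_log_atTop.comp
        (tendsto_id.const_mul_atTop hΩ)).eventually_gt_atTop 0] with t ht hlt
      exact mul_ne_zero (Real.sqrt_pos.2 hlt).ne' ht.ne'
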